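/- Let $X$ be a measurable space with countably generated $\sigma$-algebra, and let $d_{\mathrm{TV}}(p,q)=\sup_B|p(B)-q(B)|$ (supremum over measurable $B$) for probability distributions $p,q$ on $X$. A class is a set of probability distributions on $X$. A learner $A$ maps, measurably for each $n$, samples $S\in X^n$ to probability distributions on $X$. A randomized learner maps each sample to a random probability distribution on $X$, its law depending measurably on the sample (a Markov kernel). A class $\mathcal C$ is - *$\alpha$-robustly learnable* if there are a learner $A$ and $n_{\mathcal C}:(0,1)^2\to\mathbb N$ such that for every probability distribution $p$ on $X$, all $\epsilon,\delta\in(0,1)$ and all $n\ge n_{\mathcal C}(\epsilon,\delta)$, with probability at least $1-\delta$ over $S\sim p^n$, $d_{\mathrm{TV}}(A(S),p)\le\alpha\inf_{p'\in\mathcal C}d_{\mathrm{TV}}(p,p')+\epsilon$; - *additive $\alpha$-robustly learnable* if there are $A$ and $n_{\mathcal C}:(0,1)^2\to\mathbb N$ such that for every $\eta\in(0,1)$, every probability distribution $q$ on $X$, every $p\in\mathcal C$, all $\epsilon,\delta\in(0,1)$ and all $n\ge n_{\mathcal C}(\epsilon,\delta)$, with probability at least $1-\delta$ over $S\sim(\eta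 q+(1-\eta)p)^n$, $d_{\mathrm{TV}}(A(S),\eta q+(1-\eta)p)\le\alpha\eta+\epsilon$; - *subtractive $\alpha$-robustly learnable* if there are $A$ and $n_{\mathcal C}:(0,1)^2\to\mathbb N$ such that for every $\eta\in(0,1)$, every probability distribution $p$ on $X$ for which some probability distribution $q$ satisfies $\eta q+(1-\eta)p\in\mathcal C$, all $\epsilon,\delta\in(0,1)$ and all $n\ge n_{\mathcal C}(\epsilon,\delta)$, with probability at least $1-\delta$ over $S\sim p^n$, $d_{\mathrm{TV}}(A(S),p)\le\alpha\eta+\epsilon$; - *approximate-DP learnable* if there are a randomized learner $A$ and $n_{\mathcal C}:(0,1)^4\to\mathbb N$ such that for every $p\in\mathcal C$, all $\alpha,\beta,\epsilon,\delta\in(0,1)$ and all $n\ge n_{\mathcal C}(\alpha,\beta,\epsilon,\delta)$: (i) $A$ is $(\epsilon,\delta)$-differentially private on samples of size $n$, i.e. $\Pr[A(x)\in B]\le e^{\epsilon}\Pr[A(x')\in B]+\delta$ for all $x,x'\in X^n$ differing in exactly one entry and all measurable sets $B$ of distributions; and (ii) with probability at least $1-\beta$ over $S\sim p^n$ and the randomness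 of $A$, $d_{\mathrm{TV}}(p,A(S))\le\alpha$. Then: 1. Every approximate-DP learnable class $\mathcal Q$ on every such $X$ is additive $3$-robustly learnable. 2. There is an approximate-DP learnable class $\mathcal Q$ of distributions on $\mathbb N\times\mathbb N$ that is not $\alpha$-robustly learnable for any $\alpha\ge1$. 3. There is an approximate-DP learnable class $\mathcal Q$ of distributions on $\mathbb N\times\mathbb N$ that is not subtractive $\alpha$-robustly learnable for any $\alpha\ge1$. -/

import Mathlib

open MeasureTheory ProbabilityTheory

namespace DistLearn

/-- Total variation distance `sup_B |p(B) - q(B)|` over the measurable sets `B`. -/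
noncomputable def tvDist {X : Type*} [MeasurableSpace X] (p q : ProbabilityMeasure X) : ℝ :=
  ⨆ B : {B : Set X // MeasurableSet B}, |(p : Measure X).real B - (q : Measure X).real B|

/-- `inf_{p' ∈ C} d_TV(p, p')`, with the convention that it is `∞` when `C` is empty. -/
noncomputable def tvDistToClass {X : Type*} [MeasurableSpace X]
    (p : ProbabilityMeasure X) (C : Set (ProbabilityMeasure X)) : ENNReal :=
  ⨅ p' ∈ C, ENNReal.ofReal (tvDist p p')

/-- The mixture `η q + (1 - η) p`. -/
noncomputable def mixture {X : Type*} [MeasurableSpace X] (η : ℝ) (hη : η ∈ Set.Ioo (0 : ℝ) 1)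
    (q p : ProbabilityMeasure X) : ProbabilityMeasure X :=
  ⟨ENNReal.ofReal η • (q : Measure X) + ENNReal.ofReal (1 - η) • (p : Measure X), ⟨by
    simp only [Measure.coe_add, Measure.coe_smul, Pi.add_apply, Pi.smul_apply, measure_univ,
      smul_eq_mul, mul_one]
    rw [← ENNReal.ofReal_add hη.1.le (by linarith [hη.2])]
    simp⟩⟩

/-- The law `p^n` of an i.i.d. sample of size `n` from `p`. -/
noncomputable def iidSample {X : Type*} [MeasurableSpace X] (p : ProbabilityMeasure X) (n : ℕ) :
    Measure (Fin n → X) :=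
  Measure.pi fun _ => (p : Measure X)

/-- A learner: for every sample size, a measurable map from samples to distributions. -/
structure Learner (X : Type*) [MeasurableSpace X] where
  out : (n : ℕ) → (Fin n → X) → ProbabilityMeasure X
  measurable_out : ∀ n, Measurable (out n)

/-- A randomized learner: for every sample size, a Markov kernel from samples to distributions,
that is, the law of the (random) output given the sample. -/
structure RandomizedLearner (X : Type*) [MeasurableSpace X] where
  out : (n : ℕ) → Kernel (Fin n → X) (ProbabilityMeasure X)
  isMarkovKernel_out : ∀ n, IsMarkovKernel (out n)

/-- `C` is `α`-robustly learnable. -/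
def RobustlyLearnable {X : Type*} [MeasurableSpace X] (α : ℝ)
    (C : Set (ProbabilityMeasure X)) : Prop :=
  ∃ (A : Learner X) (nC : ℝ → ℝ → ℕ), ∀ p : ProbabilityMeasure X,
    ∀ ε ∈ Set.Ioo (0 : ℝ) 1, ∀ δ ∈ Set.Ioo (0 : ℝ) 1, ∀ n ≥ nC ε δ,
      ENNReal.ofReal (1 - δ) ≤ iidSample p n
        {S | ENNReal.ofReal (tvDist (A.out n S) p) ≤
          ENNReal.ofReal α * tvDistToClass p C + ENNReal.ofReal ε}

/-- `C` is additive `α`-robustly learnable. -/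
def AdditiveRobustlyLearnable {X : Type*} [MeasurableSpace X] (α : ℝ)
    (C : Set (ProbabilityMeasure X)) : Prop :=
  ∃ (A : Learner X) (nC : ℝ → ℝ → ℕ),
    ∀ (η : ℝ) (hη : η ∈ Set.Ioo (0 : ℝ) 1) (q : ProbabilityMeasure X), ∀ p ∈ C,
    ∀ ε ∈ Set.Ioo (0 : ℝ) 1, ∀ δ ∈ Set.Ioo (0 : ℝ) 1, ∀ n ≥ nC ε δ,
      ENNReal.ofReal (1 - δ) ≤ iidSample (mixture η hη q p) n
        {S | tvDist (A.out n S) (mixture η hη q p) ≤ α * η + ε}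

/-- `C` is subtractive `α`-robustly learnable. -/
def SubtractiveRobustlyLearnable {X : Type*} [MeasurableSpace X] (α : ℝ)
    (C : Set (ProbabilityMeasure X)) : Prop :=
  ∃ (A : Learner X) (nC : ℝ → ℝ → ℕ),
    ∀ (η : ℝ) (hη : η ∈ Set.Ioo (0 : ℝ) 1) (p : ProbabilityMeasure X),
    (∃ q : ProbabilityMeasure X, mixture η hη q p ∈ C) →
    ∀ ε ∈ Set.Ioo (0 : ℝ) 1, ∀ δ ∈ Set.Ioo (0 : ℝ) 1, ∀ n ≥ nC ε δ,
      ENNReal.ofReal (1 - δ) ≤ iidSample p n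
        {S | tvDist (A.out n S) p ≤ α * η + ε}

/-- The randomized algorithm `M : X^n → Y` is `(ε, δ)`-differentially private. -/
def IsDP {X Y : Type*} [MeasurableSpace X] [MeasurableSpace Y] {n : ℕ} (ε δ : ℝ)
    (M : Kernel (Fin n → X) Y) : Prop :=
  ∀ x x' : Fin n → X, (∃ i, x i ≠ x' i ∧ ∀ j, j ≠ i → x j = x' j) →
    ∀ B : Set Y, MeasurableSet B →
      M x B ≤ ENNReal.ofReal (Real.exp ε) * M x' B + ENNReal.ofReal δ

/-- `C` is approximate DP learnable. The measure `A.out n ∘ₘ iidSample p n` is the law of the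
output of `A` when the sample is drawn i.i.d. from `p`. -/
def ApproxDPLearnable {X : Type*} [MeasurableSpace X] (C : Set (ProbabilityMeasure X)) : Prop :=
  ∃ (A : RandomizedLearner X) (nC : ℝ → ℝ → ℝ → ℝ → ℕ), ∀ p ∈ C,
    ∀ α ∈ Set.Ioo (0 : ℝ) 1, ∀ β ∈ Set.Ioo (0 : ℝ) 1,
    ∀ ε ∈ Set.Ioo (0 : ℝ) 1, ∀ δ ∈ Set.Ioo (0 : ℝ) 1, ∀ n ≥ nC α β ε δ,
      IsDP ε δ (A.out n) ∧
      ENNReal.ofReal (1 - β) ≤ (A.out n ∘ₘ iidSample p n) {h | tvDist p h ≤ α}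

end DistLearn

/-! Additive robustness. Let a learner be accurate for every `p ∈ Q` on clean samples of size `m`.
If `η ≥ 1/3`, the target `3η + ε` exceeds `1` and any output will do. Otherwise the mixture `μ`
dominates `(2/3) p`, so `μ^m` dominates `(2/3)^m p^m` (`pow_mul_iidSample_le`), and a batch drawn
from `μ` makes the learner succeed with a probability bounded below independently of `p`, `q`, `η`.
Among enough independent batches, one output is probably close to `p`, hence within about `η` of
`μ`. Minimum distance selection on fresh data (`exists_measurable_selector`) loses the factor `3`.
Random outputs are replaced by their means, and `exists_uniform_procedure` removes the dependence of
the procedure on `ε`.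

Negative results. Both use the class of laws `codedLaw`. With `v = 1 / (j + 2)`, such a law puts
mass `v ^ 2` on a point encoding all parameters and the rest on an observation law that is hard to
learn, but only on a part of weight `v`. If `v` is small compared with the accuracy, the law is
close to a fixed point mass; if not, the code point soon appears in the sample. So the class is
learnable, and subsampling makes the learner private (`approxDPLearnable_of_learner`). Removing the
code point is a subtractive contamination of size only `v ^ 2`, yet what remains cannot be learned
to within `v / 4` from a number of samples independent of `N`
(`exists_iidSample_observationLaw_lt`). As `α * v ^ 2` is far below `v` for small `v`, no `α` works.
Robust learnability implies subtractive robust learnability, so the same class serves twice. -/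

namespace DistLearn

/-! ### Total variation: metric properties, measurability, and averaging of random distributions. -/

section TotalVariation

variable {X : Type*} [MeasurableSpace X]

lemma abs_measureReal_sub_le_one (p q : ProbabilityMeasure X) (B : Set X) :
    |(p : Measure X).real B - (q : Measure X).real B| ≤ 1 := by
  have h1 : (p : Measure X).real B ≤ 1 := measureReal_le_one
  have h2 : (q : Measure X).real B ≤ 1 := measureReal_le_one
  have h3 : 0 ≤ (p : Measure X).real B := measureReal_nonneg
  have h4 : 0 ≤ (q : Measure X).real B := measureReal_nonneg
  rw [abs_le]
  constructor <;> linarith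

lemma abs_measureReal_sub_le_tvDist (p q : ProbabilityMeasure X) {B : Set X}
    (hB : MeasurableSet B) :
    |(p : Measure X).real B - (q : Measure X).real B| ≤ tvDist p q :=
  le_ciSup (f := fun B : {B : Set X // MeasurableSet B} =>
    |(p : Measure X).real B - (q : Measure X).real B|)
    ⟨1, by rintro _ ⟨B, rfl⟩; exact abs_measureReal_sub_le_one p q B⟩ ⟨B, hB⟩

lemma tvDist_le {p q : ProbabilityMeasure X} {r : ℝ}
    (h : ∀ B, MeasurableSet B → |(p : Measure X).real B - (q : Measure X).real B| ≤ r) :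
    tvDist p q ≤ r :=
  haveI : Nonempty {B : Set X // MeasurableSet B} := ⟨⟨∅, MeasurableSet.empty⟩⟩
  ciSup_le fun B => h B B.2

/-- A one-sided bound suffices, by passing to complements. -/
lemma tvDist_le_of_sub_le {p q : ProbabilityMeasure X} {r : ℝ}
    (h : ∀ B, MeasurableSet B → (p : Measure X).real B - (q : Measure X).real B ≤ r) :
    tvDist p q ≤ r := by
  refine tvDist_le fun B hB => abs_le.2 ⟨?_, h B hB⟩
  have := h Bᶜ hB.compl
  rw [probReal_compl_eq_one_sub hB, probReal_compl_eq_one_sub hB] at this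
  linarith

lemma tvDist_nonneg (p q : ProbabilityMeasure X) : 0 ≤ tvDist p q :=
  (abs_nonneg _).trans (abs_measureReal_sub_le_tvDist p q MeasurableSet.empty)

lemma tvDist_le_one (p q : ProbabilityMeasure X) : tvDist p q ≤ 1 :=
  tvDist_le fun B _ => abs_measureReal_sub_le_one p q B

lemma tvDist_self (p : ProbabilityMeasure X) : tvDist p p = 0 :=
  le_antisymm (tvDist_le fun B _ => by simp) (tvDist_nonneg p p)

lemma tvDist_comm (p q : ProbabilityMeasure X) : tvDist p q = tvDist q p := by
  simp only [tvDist, abs_sub_comm]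

lemma tvDist_triangle (p q r : ProbabilityMeasure X) :
    tvDist p r ≤ tvDist p q + tvDist q r :=
  tvDist_le fun _ hB => (abs_sub_le _ _ _).trans
    (add_le_add (abs_measureReal_sub_le_tvDist p q hB) (abs_measureReal_sub_le_tvDist q r hB))

lemma mixture_real_apply {η : ℝ} (hη : η ∈ Set.Ioo (0 : ℝ) 1) (q p : ProbabilityMeasure X)
    (B : Set X) : (mixture η hη q p : Measure X).real B =
      η * (q : Measure X).real B + (1 - η) * (p : Measure X).real B := by
  have h : (mixture η hη q p : Measure X) =
    ENNReal.ofReal η • (q : Measure X) + ENNReal.ofReal (1 - η) • (p : Measure X) := rfl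
  have hq : (ENNReal.ofReal η • (q : Measure X)) B ≠ ⊤ := by
    simpa using ENNReal.mul_ne_top ENNReal.ofReal_ne_top (measure_ne_top (q : Measure X) B)
  have hp : (ENNReal.ofReal (1 - η) • (p : Measure X)) B ≠ ⊤ := by
    simpa using ENNReal.mul_ne_top ENNReal.ofReal_ne_top (measure_ne_top (p : Measure X) B)
  rw [h, measureReal_add_apply hq hp, measureReal_ennreal_smul_apply, measureReal_ennreal_smul_apply,
    ENNReal.toReal_ofReal hη.1.le, ENNReal.toReal_ofReal (by linarith [hη.2])]

lemma tvDist_mixture_le {η : ℝ} (hη : η ∈ Set.Ioo (0 : ℝ) 1) (q p : ProbabilityMeasure X) :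
    tvDist p (mixture η hη q p) ≤ η := by
  refine tvDist_le fun B _ => ?_
  have h : (p : Measure X).real B - (η * (q : Measure X).real B + (1 - η) * (p : Measure X).real B)
    = η * ((p : Measure X).real B - (q : Measure X).real B) := by ring
  rw [mixture_real_apply, h, abs_mul, abs_of_pos hη.1]
  exact mul_le_of_le_one_right hη.1.le (abs_measureReal_sub_le_one p q B)

/-- In a countably generated space, the supremum in the total variation distance can be taken over
a fixed sequence of sets. -/
lemma exists_seq_tvDist_lt (X : Type*) [MeasurableSpace X]
    [MeasurableSpace.CountablyGenerated X] :
    ∃ U : ℕ → Set X, (∀ k, MeasurableSet (U k)) ∧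
      ∀ (p q : ProbabilityMeasure X) (ε : ℝ), 0 < ε →
        ∃ k, tvDist p q - ε < |(p : Measure X).real (U k) - (q : Measure X).real (U k)| := by
  obtain ⟨b, hb, hgen⟩ := MeasurableSpace.CountablyGenerated.isCountablyGenerated (α := X)
  have hA : IsSetAlgebra (generateSetAlgebra b) := isSetAlgebra_generateSetAlgebra
  have hgen' : ‹MeasurableSpace X› = MeasurableSpace.generateFrom (generateSetAlgebra b) := by
    rw [generateFrom_generateSetAlgebra_eq, hgen]
  obtain ⟨U, hU⟩ := (countable_generateSetAlgebra hb).exists_eq_range ⟨_, hA.empty_mem⟩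
  refine ⟨U, fun k => ?_, fun p q ε hε => ?_⟩
  · exact (Measure.MeasureDense.of_generateFrom_isSetAlgebra_finite
      (0 : Measure X) hA hgen').measurable _ (hU ▸ Set.mem_range_self k)
  · by_contra! hcon
    have : tvDist p q ≤ tvDist p q - ε / 2 := by
      refine tvDist_le fun B hB => ?_
      -- Approximating in `p + q` makes the symmetric difference small for both measures at once.
      obtain ⟨t, ht, hBt⟩ := (Measure.MeasureDense.of_generateFrom_isSetAlgebra_finite
        ((p : Measure X) + (q : Measure X)) hA hgen').approx B hB (measure_ne_top _ _) (ε / 2)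
          (by positivity)
      have htm : MeasurableSet t := hgen' ▸ MeasurableSpace.measurableSet_generateFrom ht
      obtain ⟨k, rfl⟩ : t ∈ Set.range U := hU ▸ ht
      have h1 : ((p : Measure X) + (q : Measure X)).real (symmDiff B (U k)) < ε / 2 := by
        rw [measureReal_def]
        exact (ENNReal.lt_ofReal_iff_toReal_lt (measure_ne_top _ _)).1 hBt
      rw [measureReal_add_apply] at h1
      have h2 := abs_measureReal_sub_le_measureReal_symmDiff' (μ := (p : Measure X))
        hB.nullMeasurableSet htm.nullMeasurableSet (measure_ne_top _ _) (measure_ne_top _ _)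
      have h3 := abs_measureReal_sub_le_measureReal_symmDiff' (μ := (q : Measure X))
        hB.nullMeasurableSet htm.nullMeasurableSet (measure_ne_top _ _) (measure_ne_top _ _)
      have h4 := hcon k
      rw [abs_le] at *
      constructor <;> linarith [h2.1, h2.2, h3.1, h3.2, h4.1, h4.2]
    linarith

lemma measurable_toMeasure : Measurable fun p : ProbabilityMeasure X => (p : Measure X) :=
  measurable_subtype_coe

lemma measurable_measureReal_probabilityMeasure {B : Set X} (hB : MeasurableSet B) :
    Measurable fun p : ProbabilityMeasure X => (p : Measure X).real B :=
  ((Measure.measurable_coe hB).comp measurable_toMeasure).ennreal_toReal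

/-- The supremum over all measurable sets reduces to one over a fixed sequence, hence is measurable.
-/
lemma measurable_tvDist [MeasurableSpace.CountablyGenerated X] :
    Measurable fun h : ProbabilityMeasure X × ProbabilityMeasure X => tvDist h.1 h.2 := by
  obtain ⟨U, hU, hUapprox⟩ := exists_seq_tvDist_lt X
  have key : (fun h : ProbabilityMeasure X × ProbabilityMeasure X => tvDist h.1 h.2) =
      fun h => ⨆ k, |(h.1 : Measure X).real (U k) - (h.2 : Measure X).real (U k)| := by
    ext ⟨p, q⟩
    refine le_antisymm (le_of_forall_pos_le_add fun ε hε => ?_)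
      (ciSup_le fun k => abs_measureReal_sub_le_tvDist p q (hU k))
    obtain ⟨k, hk⟩ := hUapprox p q ε hε
    have := le_ciSup (f := fun k => |(p : Measure X).real (U k) - (q : Measure X).real (U k)|)
      ⟨1, by rintro _ ⟨B, rfl⟩; exact abs_measureReal_sub_le_one p q _⟩ k
    dsimp only at this ⊢
    linarith
  rw [key]
  refine Measurable.iSup fun k => ?_
  have h := measurable_measureReal_probabilityMeasure (hU k)
  have h1 : Measurable fun h : ProbabilityMeasure X × ProbabilityMeasure X =>
    (h.1 : Measure X).real (U k) := h.comp measurable_fst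
  have h2 : Measurable fun h : ProbabilityMeasure X × ProbabilityMeasure X =>
    (h.2 : Measure X).real (U k) := h.comp measurable_snd
  exact (h1.sub h2).abs

lemma measurableSet_tvDist_le [MeasurableSpace.CountablyGenerated X] (p : ProbabilityMeasure X)
    (r : ℝ) : MeasurableSet {h | tvDist p h ≤ r} :=
  have h : Measurable fun h : ProbabilityMeasure X => (p, h) := measurable_const.prodMk measurable_id
  (measurable_tvDist.comp h) (measurableSet_Iic (a := r))

/-- The mean of a law on the space of probability distributions. -/
noncomputable def mean (L : Measure (ProbabilityMeasure X)) [IsProbabilityMeasure L] :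
    ProbabilityMeasure X :=
  ⟨L.bind fun h => (h : Measure X), ⟨by
    rw [Measure.bind_apply MeasurableSet.univ measurable_toMeasure.aemeasurable]
    simp⟩⟩

lemma mean_real_apply (L : Measure (ProbabilityMeasure X)) [IsProbabilityMeasure L] {B : Set X}
    (hB : MeasurableSet B) :
    (mean L : Measure X).real B = ∫ h, (h : Measure X).real B ∂L := by
  have h : (mean L : Measure X) B = ∫⁻ h, (h : Measure X) B ∂L :=
    Measure.bind_apply hB measurable_toMeasure.aemeasurable
  rw [measureReal_def, h]
  simp only [measureReal_def]
  refine (integral_toReal ?_ ?_).symm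
  · exact ((Measure.measurable_coe hB).comp measurable_toMeasure).aemeasurable
  · exact .of_forall fun h => measure_lt_top _ _

/-- Averaging is linear on each set: the difference `p(B) - h(B)` is at most `r` at an accurate `h`
and at most `1` at any other. -/
lemma tvDist_mean_le [MeasurableSpace.CountablyGenerated X] (p : ProbabilityMeasure X)
    (L : Measure (ProbabilityMeasure X)) [IsProbabilityMeasure L] {r : ℝ}
    (hr : 0 ≤ r) :
    tvDist p (mean L) ≤ r + L.real {h | ¬ tvDist p h ≤ r} := by
  refine tvDist_le_of_sub_le fun B hB => ?_
  have hS : MeasurableSet {h | ¬ tvDist p h ≤ r} := (measurableSet_tvDist_le p r).compl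
  have hi : Integrable (fun h : ProbabilityMeasure X => (h : Measure X).real B) L :=
    Integrable.of_bound (measurable_measureReal_probabilityMeasure hB).aestronglyMeasurable 1
      (.of_forall fun h => by
        rw [Real.norm_of_nonneg measureReal_nonneg]; exact measureReal_le_one)
  have hi2 : Integrable ({h | ¬ tvDist p h ≤ r}.indicator fun _ => (1 : ℝ)) L :=
    (integrable_const 1).indicator hS
  rw [mean_real_apply L hB]
  have h1 : (p : Measure X).real B - ∫ h, (h : Measure X).real B ∂L =
      ∫ h, ((p : Measure X).real B - (h : Measure X).real B) ∂L := by
    rw [integral_sub (integrable_const _) hi]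
    simp
  have h2 : r + L.real {h | ¬ tvDist p h ≤ r} =
      ∫ h, (r + {h | ¬ tvDist p h ≤ r}.indicator (fun _ => (1 : ℝ)) h) ∂L := by
    rw [integral_add (integrable_const _) hi2, integral_indicator_const _ hS]
    simp
  rw [h1, h2]
  refine integral_mono ((integrable_const _).sub hi) ((integrable_const _).add hi2) fun h => ?_
  by_cases hh : tvDist p h ≤ r
  · simpa [hh] using (le_abs_self _).trans ((abs_measureReal_sub_le_tvDist p h hB).trans hh)
  · have := (le_abs_self _).trans (abs_measureReal_sub_le_one p h B)
    rw [Set.indicator_of_mem hh]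
    linarith

end TotalVariation

/-! ### I.i.d. samples: domination, derandomization by means, empirical frequencies. -/

section Samples

variable {X Y : Type*} [MeasurableSpace X] [MeasurableSpace Y]

instance (p : ProbabilityMeasure X) (n : ℕ) : IsProbabilityMeasure (iidSample p n) := by
  unfold iidSample; infer_instance

lemma ofReal_one_sub_le_iff_measure_compl_le (π : Measure Y) [IsProbabilityMeasure π] {S : Set Y}
    (hS : MeasurableSet S) {β : ℝ} (hβ : 0 ≤ β) :
    ENNReal.ofReal (1 - β) ≤ π S ↔ π Sᶜ ≤ ENNReal.ofReal β := by
  rw [ENNReal.ofReal_le_iff_le_toReal (measure_ne_top _ _),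
    ENNReal.le_ofReal_iff_toReal_le (measure_ne_top _ _) hβ, ← measureReal_def, ← measureReal_def,
    probReal_compl_eq_one_sub hS]
  constructor <;> intro h <;> linarith

/-- If `μ` dominates `c p`, then `μ^m` dominates `c^m p^m`. -/
lemma pow_mul_iidSample_le {p μ : ProbabilityMeasure X} {c : ENNReal}
    (h : c • (p : Measure X) ≤ μ) (m : ℕ) {E : Set (Fin m → X)} (hE : MeasurableSet E) :
    c ^ m * iidSample p m E ≤ iidSample μ m E := by
  -- The product outer measure is the largest one bounded on boxes by the product of the marginals,
  -- so a comparison on boxes is enough.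
  have key : (c ^ m • iidSample p m).toOuterMeasure ≤
      OuterMeasure.pi fun _ : Fin m => (μ : Measure X).toOuterMeasure := by
    rw [OuterMeasure.le_pi]
    intro s _
    have h1 : (c ^ m • iidSample p m) (Set.univ.pi s) = ∏ i, c * (p : Measure X) (s i) := by
      rw [Measure.smul_apply, iidSample, Measure.pi_pi, Finset.prod_mul_distrib]
      simp
    refine h1.trans_le (Finset.prod_le_prod' fun i _ => ?_)
    simpa using h (s i)
  have h2 : iidSample μ m E =
      (OuterMeasure.pi fun _ : Fin m => (μ : Measure X).toOuterMeasure) E := by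
    rw [iidSample, Measure.pi, toMeasure_apply _ _ hE]
  rw [h2]
  simpa using key E

lemma one_sub_smul_le_mixture {η : ℝ} (hη : η ∈ Set.Ioo (0 : ℝ) 1) (q p : ProbabilityMeasure X) :
    ENNReal.ofReal (1 - η) • (p : Measure X) ≤ mixture η hη q p :=
  Measure.le_add_left le_rfl

/-- Replacing the random output of a learner by its mean preserves accuracy. -/
lemma half_le_measure_tvDist_mean_le [MeasurableSpace.CountablyGenerated X]
    (κ : Kernel Y (ProbabilityMeasure X)) [IsMarkovKernel κ] (π : Measure Y)
    [IsProbabilityMeasure π] (p : ProbabilityMeasure X) {r γ : ℝ} (hr : 0 ≤ r) (hγ : 0 < γ)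
    (h : ENNReal.ofReal (1 - γ / 2) ≤ (κ ∘ₘ π) {h | tvDist p h ≤ r}) :
    1 / 2 ≤ π {y | tvDist p (mean (κ y)) ≤ r + γ} := by
  have hS := measurableSet_tvDist_le p r
  have hbad : ∫⁻ y, κ y {h | tvDist p h ≤ r}ᶜ ∂π ≤ ENNReal.ofReal (γ / 2) := by
    rw [← Measure.bind_apply hS.compl κ.aemeasurable]
    exact (ofReal_one_sub_le_iff_measure_compl_le _ hS (by positivity)).1 h
  have hm : Measurable fun y => κ y {h | tvDist p h ≤ r}ᶜ := κ.measurable_coe hS.compl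
  have hmarkov := mul_meas_ge_le_lintegral (μ := π) hm (ENNReal.ofReal γ)
  -- Markov's inequality: the failure probability given the sample has mean at most `γ / 2`, so it
  -- reaches `γ` with probability at most `1 / 2`.
  have h1 : π {y | ENNReal.ofReal γ ≤ κ y {h | tvDist p h ≤ r}ᶜ} ≤ 1 / 2 := by
    have h2 := hmarkov.trans hbad
    rw [mul_comm] at h2
    have := ENNReal.le_div_iff_mul_le (b := ENNReal.ofReal γ) (c := ENNReal.ofReal (γ / 2))
      (.inl (by simpa using hγ)) (.inl ENNReal.ofReal_ne_top) |>.2 h2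
    refine this.trans_eq ?_
    rw [← ENNReal.ofReal_div_of_pos hγ, show γ / 2 / γ = 1 / 2 by field_simp,
      ENNReal.ofReal_div_of_pos two_pos]
    simp
  have h2 : 1 / 2 ≤ π {y | ENNReal.ofReal γ ≤ κ y {h | tvDist p h ≤ r}ᶜ}ᶜ := by
    rw [prob_compl_eq_one_sub (measurableSet_le measurable_const hm)]
    refine le_trans ?_ (tsub_le_tsub_left h1 1)
    simp
  refine h2.trans (measure_mono fun y hy => ?_)
  have hy' : κ y {h | tvDist p h ≤ r}ᶜ < ENNReal.ofReal γ := not_le.1 hy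
  refine (tvDist_mean_le p (κ y) hr).trans ?_
  have : (κ y).real {h | tvDist p h ≤ r}ᶜ < γ :=
    (ENNReal.lt_ofReal_iff_toReal_lt (measure_ne_top _ _)).1 hy'
  simp only [← Set.compl_ofPred]
  linarith

lemma measurable_mean (κ : Kernel Y (ProbabilityMeasure X)) [IsMarkovKernel κ] :
    Measurable fun y => mean (κ y) :=
  ((Measure.measurable_bind' measurable_toMeasure).comp κ.measurable).subtype_mk

/-- The empirical frequency of a set in a sample. -/
noncomputable def empiricalFreq {N : ℕ} (T : Fin N → X) (B : Set X) : ℝ :=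
  (∑ i, B.indicator (fun _ => (1 : ℝ)) (T i)) / N

lemma measurable_empiricalFreq {N : ℕ} {B : Set X} (hB : MeasurableSet B) :
    Measurable fun T : Fin N → X => empiricalFreq T B :=
  (Finset.measurable_sum _ fun i _ =>
    (measurable_const.indicator hB).comp (measurable_pi_apply i)).div_const _

/-- Chebyshev's inequality for the empirical frequency. -/
lemma iidSample_abs_empiricalFreq_sub_gt_le (μ : ProbabilityMeasure X) {N : ℕ} (hN : 0 < N)
    {B : Set X} (hB : MeasurableSet B) {ε : ℝ} (hε : 0 < ε) :
    iidSample μ N {T | ε < |empiricalFreq T B - (μ : Measure X).real B|} ≤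
      ENNReal.ofReal (1 / (N * ε ^ 2)) := by
  have hN' : (0 : ℝ) < N := by exact_mod_cast hN
  set f : X → ℝ := B.indicator fun _ => 1 with hf
  have hfm : Measurable f := measurable_const.indicator hB
  have hf01 : ∀ x, f x ∈ Set.Icc (0 : ℝ) 1 := fun x => by
    by_cases hx : x ∈ B <;> simp [hf, hx]
  have hfL : MemLp f 2 (μ : Measure X) := MemLp.of_bound hfm.aestronglyMeasurable 1
    (.of_forall fun x => by rw [Real.norm_of_nonneg (hf01 x).1]; exact (hf01 x).2)
  set F : (Fin N → X) → ℝ := ∑ i, fun T => f (T i) with hF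
  have hFL : MemLp F 2 (iidSample μ N) := by
    refine memLp_finsetSum' _ fun i _ => ?_
    exact hfL.comp_measurePreserving (measurePreserving_eval (fun _ => (μ : Measure X)) i)
  have hvar : Var[F; iidSample μ N] ≤ N := by
    rw [hF, iidSample, variance_sum_pi fun _ => hfL]
    have : Var[f; (μ : Measure X)] ≤ 1 :=
      (variance_le_sq_of_bounded (.of_forall hf01) hfm.aemeasurable).trans (by norm_num)
    calc _ ≤ ∑ _i : Fin N, (1 : ℝ) := Finset.sum_le_sum fun _ _ => this
      _ = N := by simp
  have hmean : ∫ T, F T ∂(iidSample μ N) = N * (μ : Measure X).real B := by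
    have : ∀ T, F T = ∑ i, f (T i) := fun T => by simp [hF]
    simp_rw [this]
    rw [integral_finsetSum]
    · have h1 : ∀ i : Fin N, ∫ T, f (T i) ∂(iidSample μ N) = (μ : Measure X).real B := fun i => by
        rw [iidSample, integral_comp_eval (μ := fun _ : Fin N => (μ : Measure X))
          hfm.aestronglyMeasurable, hf, integral_indicator_const _ hB]
        simp
      simp [h1]
    · intro i _
      exact (hfL.comp_measurePreserving
        (measurePreserving_eval (fun _ => (μ : Measure X)) i)).integrable one_le_two
  have hcheb := meas_ge_le_variance_div_sq hFL (c := N * ε) (by positivity)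
  refine (measure_mono fun T hT => ?_).trans (hcheb.trans (ENNReal.ofReal_le_ofReal ?_))
  · have hT' : ε < |empiricalFreq T B - (μ : Measure X).real B| := hT
    have h2 : F T - N * (μ : Measure X).real B =
        N * (empiricalFreq T B - (μ : Measure X).real B) := by
      rw [empiricalFreq, hF, Finset.sum_apply]
      field_simp
      rfl
    change N * ε ≤ |F T - ∫ T, F T ∂(iidSample μ N)|
    rw [hmean, h2, abs_mul, abs_of_pos hN']
    exact mul_le_mul_of_nonneg_left hT'.le hN'.le
  · calc _ ≤ N / (N * ε) ^ 2 := by gcongr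
      _ = 1 / (N * ε ^ 2) := by field_simp

end Samples

/-! ### Additive robustness by batching and minimum distance selection. -/

section AdditiveRobustness

variable {X : Type*} [MeasurableSpace X]

/-- The first admissible index in an enumeration depends measurably on `ω`. -/
lemma exists_measurable_choice {Ω ι : Type*} [MeasurableSpace Ω] [Countable ι] [Nonempty ι]
    [MeasurableSpace ι] (R : Ω → ι → Prop) (hR : ∀ i, MeasurableSet {ω | R ω i})
    (h : ∀ ω, ∃ i, R ω i) : ∃ c : Ω → ι, Measurable c ∧ ∀ ω, R ω (c ω) := by
  classical
  obtain ⟨e, he⟩ := exists_surjective_nat ι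
  have hexists : ∀ ω, ∃ k, R ω (e k) := fun ω => by
    obtain ⟨i, hi⟩ := h ω
    obtain ⟨k, rfl⟩ := he i
    exact ⟨k, hi⟩
  exact ⟨fun ω => e (Nat.find (hexists ω)),
    (measurable_from_nat (f := e)).comp (measurable_find hexists fun k => hR (e k)),
    fun ω => Nat.find_spec (hexists ω)⟩

/-- Minimum distance selection: from `K` candidates and a fresh test sample, one can choose a
candidate which, unless the test sample is atypical, is almost `3`-competitive. -/
lemma exists_measurable_selector [MeasurableSpace.CountablyGenerated X] {K N : ℕ} (hK : 0 < K)
    (hN : 0 < N) {ε : ℝ} (hε : 0 < ε) :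
    ∃ G : (Fin K → ProbabilityMeasure X) × (Fin N → X) → ProbabilityMeasure X, Measurable G ∧
      ∀ μ : ProbabilityMeasure X, ∃ bad : Set ((Fin K → ProbabilityMeasure X) × (Fin N → X)),
        MeasurableSet bad ∧
        (∀ H, iidSample μ N {T | (H, T) ∈ bad} ≤ ENNReal.ofReal (K ^ 2 * (1 / (N * ε ^ 2)))) ∧
        ∀ H T, (H, T) ∉ bad → ∀ i, tvDist (G (H, T)) μ ≤ 3 * tvDist (H i) μ + 3 * ε := by
  have : Nonempty (Fin K) := ⟨⟨0, hK⟩⟩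
  obtain ⟨U, hU, hUapprox⟩ := exists_seq_tvDist_lt X
  have hfst : ∀ l, Measurable fun h : ProbabilityMeasure X × ProbabilityMeasure X =>
      (h.1 : Measure X).real (U l) := fun l =>
    (measurable_measureReal_probabilityMeasure (hU l)).comp measurable_fst
  have hsnd : ∀ l, Measurable fun h : ProbabilityMeasure X × ProbabilityMeasure X =>
      (h.2 : Measure X).real (U l) := fun l =>
    (measurable_measureReal_probabilityMeasure (hU l)).comp measurable_snd
  -- Approximate Scheffé sets: `U (k (p, q))` nearly attains the total variation distance of `p` and
  -- `q`, with a measurably chosen index.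
  obtain ⟨k, hk, hkU⟩ := exists_measurable_choice
    (fun (h : ProbabilityMeasure X × ProbabilityMeasure X) (l : ℕ) =>
      tvDist h.1 h.2 - ε < |(h.1 : Measure X).real (U l) - (h.2 : Measure X).real (U l)|)
    (fun l => measurableSet_lt (measurable_tvDist.sub_const ε) ((hfst l).sub (hsnd l)).abs)
    (fun h => hUapprox h.1 h.2 ε hε)
  let Ω := (Fin K → ProbabilityMeasure X) × (Fin N → X)
  have hkm : ∀ i j, Measurable fun ω : Ω => k (ω.1 i, ω.1 j) := fun i j =>
    hk.comp (((measurable_pi_apply i).comp measurable_fst).prodMk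
      ((measurable_pi_apply j).comp measurable_fst))
  have hemp : ∀ l, Measurable fun ω : Ω => empiricalFreq ω.2 (U l) := fun l =>
    (measurable_empiricalFreq (hU l)).comp measurable_snd
  have hcand : ∀ i l, Measurable fun ω : Ω => (ω.1 i : Measure X).real (U l) := fun i l =>
    (measurable_measureReal_probabilityMeasure (hU l)).comp
      ((measurable_pi_apply i).comp measurable_fst)
  have hcomp : ∀ i j (F : Ω → ℕ → ℝ), (∀ l, Measurable fun ω => F ω l) →
      Measurable fun ω : Ω => F ω (k (ω.1 i, ω.1 j)) := fun i j F hF =>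
    (measurable_from_prod_countable_left (f := fun z : Ω × ℕ => F z.1 z.2) hF).comp
      (measurable_id.prodMk (hkm i j))
  let dev : Ω → Fin K → Fin K → ℝ := fun ω i j =>
    |(ω.1 i : Measure X).real (U (k (ω.1 i, ω.1 j))) -
      empiricalFreq ω.2 (U (k (ω.1 i, ω.1 j)))|
  have hdev : ∀ i j, Measurable fun ω => dev ω i j := fun i j =>
    hcomp i j (fun ω l => |(ω.1 i : Measure X).real (U l) - empiricalFreq ω.2 (U l)|)
      fun l => ((hcand i l).sub (hemp l)).abs
  -- The score of a candidate is its worst discrepancy with the empirical frequencies on its own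
  -- Scheffé sets; the selector minimizes it.
  let W : Ω → Fin K → ℝ := fun ω i => ⨆ j, dev ω i j
  have hW : ∀ i, Measurable fun ω => W ω i := fun i => Measurable.iSup fun j => hdev i j
  have hdevW : ∀ ω i j, dev ω i j ≤ W ω i := fun ω i j =>
    le_ciSup (Set.finite_range (dev ω i)).bddAbove j
  obtain ⟨c, hc, hcW⟩ := exists_measurable_choice (fun (ω : Ω) (i : Fin K) => ∀ j, W ω i ≤ W ω j)
    (fun i => by
      rw [Set.ofPred_forall]
      exact MeasurableSet.iInter fun j => measurableSet_le (hW i) (hW j))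
    (fun ω => Finite.exists_min (W ω))
  refine ⟨fun ω => ω.1 (c ω), ?_, fun μ => ?_⟩
  · exact (measurable_from_prod_countable_left (f := fun z : Ω × Fin K => z.1.1 z.2)
      fun i => (measurable_pi_apply i).comp measurable_fst).comp (measurable_id.prodMk hc)
  -- For fixed candidates the test sets do not depend on the test sample, so Chebyshev and a union
  -- bound over `K ^ 2` pairs apply.
  let B : Fin K → Fin K → Set Ω := fun i j => {ω | ε <
    |empiricalFreq ω.2 (U (k (ω.1 i, ω.1 j))) - (μ : Measure X).real (U (k (ω.1 i, ω.1 j)))|}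
  have hB : ∀ i j, MeasurableSet (B i j) := fun i j => measurableSet_lt measurable_const
    (hcomp i j (fun ω l => |empiricalFreq ω.2 (U l) - (μ : Measure X).real (U l)|)
      fun l => ((hemp l).sub_const _).abs)
  refine ⟨⋃ i, ⋃ j, B i j, .iUnion fun i => .iUnion fun j => hB i j, fun H => ?_,
    fun H T hbad i => ?_⟩
  · have h1 : {T | (H, T) ∈ ⋃ i, ⋃ j, B i j} = ⋃ i, ⋃ j, {T | (H, T) ∈ B i j} := by
      ext T; simp
    rw [h1]
    calc _ ≤ ∑ i, ∑ j, iidSample μ N {T | (H, T) ∈ B i j} :=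
          (measure_iUnion_fintype_le _ _).trans
            (Finset.sum_le_sum fun i _ => measure_iUnion_fintype_le _ _)
      _ ≤ ∑ _i : Fin K, ∑ _j : Fin K, ENNReal.ofReal (1 / (N * ε ^ 2)) :=
          Finset.sum_le_sum fun i _ => Finset.sum_le_sum fun j _ =>
            iidSample_abs_empiricalFreq_sub_gt_le μ hN (hU (k (H i, H j))) hε
      _ = _ := by
          rw [ENNReal.ofReal_mul (by positivity), ENNReal.ofReal_pow (by positivity)]
          simp [sq, mul_assoc]
  · simp only [Set.mem_iUnion, not_exists] at hbad
    have hclose : ∀ i j, |empiricalFreq T (U (k (H i, H j))) -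
        (μ : Measure X).real (U (k (H i, H j)))| ≤ ε := fun i j => not_lt.1 (hbad i j)
    set a := c (H, T) with ha
    change tvDist (H a) μ ≤ _
    have hWi : W (H, T) i ≤ tvDist (H i) μ + ε := by
      refine ciSup_le fun j => ?_
      have h1 := abs_measureReal_sub_le_tvDist (H i) μ (hU (k (H i, H j)))
      have h2 := hclose i j
      have h3 := abs_sub_le ((H i : Measure X).real (U (k (H i, H j))))
        ((μ : Measure X).real (U (k (H i, H j)))) (empiricalFreq T (U (k (H i, H j))))
      rw [abs_sub_comm ((μ : Measure X).real _)] at h3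
      change |(H i : Measure X).real (U (k (H i, H j))) - empiricalFreq T (U (k (H i, H j)))| ≤ _
      linarith
    -- The distance from `H a` to `H i` is nearly attained on their Scheffé set, where the empirical
    -- frequency is within `W a ≤ W i` of `H a` and within `ε` of `μ`. One further triangle
    -- inequality gives the third copy of the distance from `H i` to `μ`.
    have h1 := tvDist_triangle (H a) (H i) μ
    have h2 : tvDist (H a) (H i) - ε < |(H a : Measure X).real (U (k (H a, H i))) -
      (H i : Measure X).real (U (k (H a, H i)))| := hkU (H a, H i)
    have h3 : |(H a : Measure X).real (U (k (H a, H i))) -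
      empiricalFreq T (U (k (H a, H i)))| ≤ W (H, T) a := hdevW (H, T) a i
    have h4 : W (H, T) a ≤ W (H, T) i := hcW (H, T) i
    have h5 := hclose a i
    have h6 := abs_measureReal_sub_le_tvDist (H i) μ (hU (k (H a, H i)))
    have h7 := abs_sub_le ((H a : Measure X).real (U (k (H a, H i))))
      (empiricalFreq T (U (k (H a, H i)))) ((H i : Measure X).real (U (k (H a, H i))))
    have h8 := abs_sub_le (empiricalFreq T (U (k (H a, H i))))
      ((μ : Measure X).real (U (k (H a, H i)))) ((H i : Measure X).real (U (k (H a, H i))))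
    rw [abs_sub_comm ((μ : Measure X).real _)] at h8
    linarith

/-- An i.i.d. sample of size `K * m + N` splits into `K` independent batches of size `m` and a
further independent sample of size `N`. -/
lemma measurePreserving_split (μ : ProbabilityMeasure X) (K m N : ℕ) :
    MeasurePreserving (fun S : Fin (K * m + N) → X =>
        ((fun b t => S (Fin.castAdd N (finProdFinEquiv (b, t))), fun t => S (Fin.natAdd (K * m) t)) :
          (Fin K → Fin m → X) × (Fin N → X)))
      (iidSample μ (K * m + N)) ((Measure.pi fun _ => iidSample μ m).prod (iidSample μ N)) := by
  set φ := fun S : Fin (K * m + N) → X =>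
    ((fun b t => S (Fin.castAdd N (finProdFinEquiv (b, t))), fun t => S (Fin.natAdd (K * m) t)) :
      (Fin K → Fin m → X) × (Fin N → X))
  have hφ : Measurable φ := by fun_prop
  -- Concatenation, of which `φ` is a left inverse. The law of `ψ` can be identified on boxes, and
  -- the claim for `φ` follows from `φ ∘ ψ = id`.
  let ψ : (Fin K → Fin m → X) × (Fin N → X) → Fin (K * m + N) → X := fun z =>
    Fin.append (fun l => z.1 (finProdFinEquiv.symm l).1 (finProdFinEquiv.symm l).2) z.2
  have hψ : Measurable ψ := by
    refine measurable_pi_iff.2 fun i => ?_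
    refine Fin.addCases (fun l => ?_) (fun l => ?_) i
    · simp only [ψ, Fin.append_left]; fun_prop
    · simp only [ψ, Fin.append_right]; fun_prop
  have hφψ : ∀ z, φ (ψ z) = z := fun z => by
    simp [φ, ψ, -finProdFinEquiv_symm_apply]
  have hmap : iidSample μ (K * m + N) =
      ((Measure.pi fun _ : Fin K => iidSample μ m).prod (iidSample μ N)).map ψ := by
    refine Measure.pi_eq fun s hs => ?_
    rw [Measure.map_apply hψ (.univ_pi hs)]
    have : ψ ⁻¹' (Set.univ.pi s) =
        (Set.univ.pi fun b : Fin K => Set.univ.pi fun t : Fin m =>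
          s (Fin.castAdd N (finProdFinEquiv (b, t)))) ×ˢ
        (Set.univ.pi fun t : Fin N => s (Fin.natAdd (K * m) t)) := by
      ext z
      simp only [Set.mem_preimage, Set.mem_univ_pi, Set.mem_prod]
      constructor
      · intro h
        refine ⟨fun b t => ?_, fun t => ?_⟩
        · simpa [ψ, -finProdFinEquiv_symm_apply] using h (Fin.castAdd N (finProdFinEquiv (b, t)))
        · simpa [ψ, -finProdFinEquiv_symm_apply] using h (Fin.natAdd (K * m) t)
      · rintro ⟨h1, h2⟩ i
        refine Fin.addCases (fun l => ?_) (fun l => ?_) i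
        · simpa [ψ, -finProdFinEquiv_symm_apply] using
            h1 (finProdFinEquiv.symm l).1 (finProdFinEquiv.symm l).2
        · simpa [ψ, -finProdFinEquiv_symm_apply] using h2 l
    rw [this, Measure.prod_prod, Measure.pi_pi, Fin.prod_univ_add]
    simp only [iidSample, Measure.pi_pi]
    rw [← finProdFinEquiv.prod_comp, Fintype.prod_prod_type]
  refine ⟨hφ, ?_⟩
  rw [hmap, Measure.map_map hφ hψ]
  have : φ ∘ ψ = id := funext hφψ
  rw [this, Measure.map_id]

/-- Boosting a learner that succeeds with probability `1/2` on clean samples: run it on many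
batches, one of which is likely to be clean, and select among the outputs. -/
lemma exists_additive_learner_of_clean_learner [MeasurableSpace.CountablyGenerated X]
    {Q : Set (ProbabilityMeasure X)} {ε : ℝ} (hε : ε ∈ Set.Ioo (0 : ℝ) 1) {m : ℕ}
    {g : (Fin m → X) → ProbabilityMeasure X} (hg : Measurable g)
    (hgQ : ∀ p ∈ Q, 1 / 2 ≤ iidSample p m {S | tvDist p (g S) ≤ ε / 6}) :
    ∃ n₀, ∀ n ≥ n₀, ∃ f : (Fin n → X) → ProbabilityMeasure X, Measurable f ∧
      ∀ (η : ℝ) (hη : η ∈ Set.Ioo (0 : ℝ) 1) (q : ProbabilityMeasure X), ∀ p ∈ Q,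
        ENNReal.ofReal (1 - ε) ≤ iidSample (mixture η hη q p) n
          {S | tvDist (f S) (mixture η hη q p) ≤ 3 * η + ε} := by
  obtain ⟨hε0, hε1⟩ := hε
  -- A lower bound for the success probability of one contaminated batch: `(2 / 3) ^ m` from
  -- domination when `η < 1 / 3`, and `1 / 2` from the clean guarantee.
  set c : ℝ := (2 / 3) ^ m / 2 with hc
  have hc0 : 0 < c := by positivity
  have hc1 : c ≤ 1 / 2 := by
    have : ((2 : ℝ) / 3) ^ m ≤ 1 := pow_le_one₀ (by norm_num) (by norm_num)
    rw [hc]; linarith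
  obtain ⟨K, hK⟩ := exists_pow_lt_of_lt_one (half_pos hε0) (show 1 - c < 1 by linarith)
  have hK0 : 0 < K := Nat.pos_of_ne_zero fun h => by
    rw [h, pow_zero] at hK; linarith
  -- Chosen so that the selector at accuracy `ε / 6` fails with probability at most `ε / 2`: this
  -- requires `36 K² / (N ε²) ≤ ε / 2`.
  obtain ⟨N₀, hN₀⟩ := exists_nat_gt ((K : ℝ) ^ 2 * (72 / ε ^ 3))
  refine ⟨K * m + (N₀ + 1), fun n hn => ?_⟩
  obtain ⟨N, rfl⟩ := Nat.exists_eq_add_of_le (show K * m ≤ n by omega)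
  have hN : N₀ < N := by omega
  have hN0 : 0 < N := by omega
  obtain ⟨G, hG, hGsel⟩ := exists_measurable_selector (X := X) hK0 hN0
    (show 0 < ε / 6 by positivity)
  let H : (Fin K → Fin m → X) × (Fin N → X) →
    (Fin K → ProbabilityMeasure X) × (Fin N → X) := fun z => (fun b => g (z.1 b), z.2)
  have hH : Measurable H := (measurable_pi_lambda _ fun b => hg.comp
    ((measurable_pi_apply b).comp measurable_fst)).prodMk measurable_snd
  have hφ := fun μ : ProbabilityMeasure X => measurePreserving_split μ K m N
  set φ := fun S : Fin (K * m + N) → X =>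
    ((fun b t => S (Fin.castAdd N (finProdFinEquiv (b, t))), fun t => S (Fin.natAdd (K * m) t)) :
      (Fin K → Fin m → X) × (Fin N → X))
  have hφm : Measurable φ := by fun_prop
  refine ⟨fun S => G (H (φ S)), hG.comp (hH.comp hφm), fun η hη q p hp => ?_⟩
  set μ := mixture η hη q p with hμ
  rcases le_or_gt (1 / 3) η with hη3 | hη3
  · have : {S | tvDist (G (H (φ S))) μ ≤ 3 * η + ε} = Set.univ :=
      Set.eq_univ_of_forall fun S => (tvDist_le_one _ _).trans (by linarith)
    rw [this, measure_univ]
    exact ENNReal.ofReal_le_one.2 (by linarith)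
  obtain ⟨bad, hbad, hbadμ, hbadsel⟩ := hGsel μ
  let D₁ : Set (Fin m → X) := {S | tvDist p (g S) ≤ ε / 6}
  have hD₁ : MeasurableSet D₁ := hg (measurableSet_tvDist_le p (ε / 6))
  have hD₁μ : iidSample μ m D₁ᶜ ≤ ENNReal.ofReal (1 - c) := by
    refine (ofReal_one_sub_le_iff_measure_compl_le _ hD₁ (by linarith)).1 ?_
    refine le_trans ?_ (pow_mul_iidSample_le (one_sub_smul_le_mixture hη q p) m hD₁)
    refine le_trans ?_ (mul_le_mul' (pow_le_pow_left' (ENNReal.ofReal_le_ofReal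
      (show 2 / 3 ≤ 1 - η by linarith)) m) (hgQ p hp))
    rw [← ENNReal.ofReal_pow (by norm_num), sub_sub_cancel, hc, div_eq_mul_one_div,
      ENNReal.ofReal_mul (by positivity), ENNReal.ofReal_div_of_pos two_pos]
    simp
  let E₁ : Set ((Fin K → Fin m → X) × (Fin N → X)) :=
    (Set.univ.pi fun _ : Fin K => D₁ᶜ) ×ˢ Set.univ
  let E₂ : Set ((Fin K → Fin m → X) × (Fin N → X)) := H ⁻¹' bad
  have hE₁ : MeasurableSet E₁ := (MeasurableSet.univ_pi fun _ => hD₁.compl).prod .univ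
  have hE₂ : MeasurableSet E₂ := hH hbad
  set P := (Measure.pi fun _ : Fin K => iidSample μ m).prod (iidSample μ N) with hP
  have hE₁P : P E₁ ≤ ENNReal.ofReal (ε / 2) := by
    rw [hP, Measure.prod_prod, Measure.pi_pi, measure_univ, mul_one]
    calc _ ≤ ∏ _b : Fin K, ENNReal.ofReal (1 - c) := Finset.prod_le_prod' fun _ _ => hD₁μ
      _ = ENNReal.ofReal ((1 - c) ^ K) := by
          rw [ENNReal.ofReal_pow (by linarith)]; simp
      _ ≤ _ := ENNReal.ofReal_le_ofReal hK.le
  have hE₂P : P E₂ ≤ ENNReal.ofReal (ε / 2) := by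
    rw [hP, Measure.prod_apply hE₂]
    have hN' : (N₀ : ℝ) < N := by exact_mod_cast hN
    have hNpos : (0 : ℝ) < N := by exact_mod_cast hN0
    have h1 : (K : ℝ) ^ 2 * (1 / (N * (ε / 6) ^ 2)) ≤ ε / 2 := by
      have h2 : (K : ℝ) ^ 2 * (72 / ε ^ 3) < N := hN₀.trans hN'
      have h3 : (K : ℝ) ^ 2 * (1 / (N * (ε / 6) ^ 2)) =
          ((K : ℝ) ^ 2 * (72 / ε ^ 3)) / N * (ε / 2) := by
        field_simp; ring
      rw [h3]
      exact mul_le_of_le_one_left (by positivity) ((div_le_one hNpos).2 h2.le)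
    calc _ ≤ ∫⁻ _, ENNReal.ofReal (ε / 2) ∂(Measure.pi fun _ : Fin K => iidSample μ m) :=
          lintegral_mono fun y => (hbadμ fun b => g (y b)).trans (ENNReal.ofReal_le_ofReal h1)
      _ = _ := by simp
  have hE : iidSample μ (K * m + N) (φ ⁻¹' (E₁ ∪ E₂)ᶜ)ᶜ ≤ ENNReal.ofReal ε := by
    rw [← Set.preimage_compl, compl_compl,
      (hφ μ).measure_preimage (hE₁.union hE₂).nullMeasurableSet]
    refine (measure_union_le _ _).trans ((add_le_add hE₁P hE₂P).trans_eq ?_)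
    rw [← ENNReal.ofReal_add (by positivity) (by positivity), add_halves]
  refine ((ofReal_one_sub_le_iff_measure_compl_le _ (hφm (hE₁.union hE₂).compl) hε0.le).2
    hE).trans (measure_mono fun S hS => ?_)
  have hS1 : φ S ∉ E₁ := fun h => hS (.inl h)
  have hS2 : H (φ S) ∉ bad := fun h => hS (.inr h)
  obtain ⟨b, hb⟩ : ∃ b, (φ S).1 b ∈ D₁ := by
    by_contra! hcon
    exact hS1 ⟨fun b _ => hcon b, trivial⟩
  have hb' : tvDist p (g ((φ S).1 b)) ≤ ε / 6 := hb
  have h1 : tvDist (G (H (φ S))) μ ≤ 3 * tvDist (g ((φ S).1 b)) μ + 3 * (ε / 6) :=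
    hbadsel _ _ hS2 b
  have h2 := tvDist_triangle (g ((φ S).1 b)) p μ
  rw [tvDist_comm _ p] at h2
  -- The good candidate is within `η + ε / 6` of `μ`, and `3 (η + ε / 6) + 3 (ε / 6) = 3 η + ε`.
  have h3 : tvDist p μ ≤ η := tvDist_mixture_le hη q p
  change tvDist (G (H (φ S))) μ ≤ 3 * η + ε
  linarith

/-- Procedures which, for each accuracy, are available at all large sample sizes can be combined
into a single procedure that does not know the accuracy. -/
lemma exists_uniform_procedure {F : ℕ → Type*} [∀ n, Nonempty (F n)] (R : ∀ n, F n → ℝ → Prop)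
    (hmono : ∀ n f ε ε', ε ≤ ε' → R n f ε → R n f ε')
    (h : ∀ ε ∈ Set.Ioo (0 : ℝ) 1, ∃ n₀, ∀ n ≥ n₀, ∃ f, R n f ε) :
    ∃ f : ∀ n, F n, ∀ ε ∈ Set.Ioo (0 : ℝ) 1, ∃ n₀, ∀ n ≥ n₀, R n (f n) ε := by
  classical
  have hk : ∀ k : ℕ, 1 / ((k : ℝ) + 2) ∈ Set.Ioo (0 : ℝ) 1 := fun k =>
    ⟨by positivity, (div_lt_one (by positivity)).2 (by linarith [k.cast_nonneg (α := ℝ)])⟩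
  choose N hN using fun k : ℕ => h _ (hk k)
  -- At sample size `n`, aim at the finest accuracy `1 / (k + 2)` with `k ≤ n` whose threshold has
  -- been passed. If none has, an arbitrary procedure is used, which only concerns small `n`.
  let κ : ℕ → ℕ := fun n => Nat.findGreatest (fun k => N k ≤ n) n
  refine ⟨fun n => if hn : N (κ n) ≤ n then (hN (κ n) n hn).choose
    else Classical.arbitrary _, fun ε hε => ?_⟩
  obtain ⟨k, hkε⟩ := exists_nat_one_div_lt hε.1
  refine ⟨max k (N k), fun n hn => ?_⟩
  have hkn : k ≤ n := (le_max_left _ _).trans hn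
  have hNk : N k ≤ n := (le_max_right _ _).trans hn
  have h1 : N (κ n) ≤ n := Nat.findGreatest_spec (P := fun k => N k ≤ n) hkn hNk
  have h2 : k ≤ κ n := Nat.le_findGreatest hkn hNk
  simp only [h1, dite_true]
  refine hmono n _ _ _ ?_ (hN (κ n) n h1).choose_spec
  refine le_trans ?_ hkε.le
  have : (k : ℝ) ≤ κ n := by exact_mod_cast h2
  exact one_div_le_one_div_of_le (by positivity) (by linarith)

theorem additiveRobustlyLearnable_three_of_approxDPLearnable
    [MeasurableSpace.CountablyGenerated X] {Q : Set (ProbabilityMeasure X)}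
    (hQ : ApproxDPLearnable Q) : AdditiveRobustlyLearnable 3 Q := by
  obtain ⟨A, nC, hA⟩ := hQ
  have hMarkov := A.isMarkovKernel_out
  have hstep : ∀ ε ∈ Set.Ioo (0 : ℝ) 1, ∃ n₀, ∀ n ≥ n₀,
      ∃ f : {f : (Fin n → X) → ProbabilityMeasure X // Measurable f},
      ∀ (η : ℝ) (hη : η ∈ Set.Ioo (0 : ℝ) 1) (q : ProbabilityMeasure X), ∀ p ∈ Q,
        ENNReal.ofReal (1 - ε) ≤ iidSample (mixture η hη q p) n
          {S | tvDist (f.1 S) (mixture η hη q p) ≤ 3 * η + ε} := by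
    intro ε hε
    have hhalf : (1 / 2 : ℝ) ∈ Set.Ioo (0 : ℝ) 1 := by norm_num
    -- Accuracy `ε / 12` with failure probability `ε / 24` puts the mean output within `ε / 12 + ε /
    -- 12 = ε / 6` of `p` with probability at least `1 / 2`.
    obtain ⟨n₀, hn₀⟩ := exists_additive_learner_of_clean_learner (Q := Q) hε
      (measurable_mean (A.out (nC (ε / 12) (ε / 12 / 2) (1 / 2) (1 / 2)))) fun p hp => by
        have h := (hA p hp (ε / 12) ⟨by linarith [hε.1], by linarith [hε.2]⟩ (ε / 12 / 2)
          ⟨by linarith [hε.1], by linarith [hε.2]⟩ _ hhalf _ hhalf _ le_rfl).2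
        have h2 := half_le_measure_tvDist_mean_le _ _ p (by linarith [hε.1])
          (by linarith [hε.1]) h
        rwa [show ε / 12 + ε / 12 = ε / 6 by ring] at h2
    refine ⟨n₀, fun n hn => ?_⟩
    obtain ⟨f, hf, hf'⟩ := hn₀ n hn
    exact ⟨⟨f, hf⟩, hf'⟩
  have hne : ∀ n, Nonempty {f : (Fin n → X) → ProbabilityMeasure X // Measurable f} := fun n =>
    ⟨⟨_, measurable_mean (A.out n)⟩⟩
  obtain ⟨f, hf⟩ := exists_uniform_procedure
    (F := fun n => {f : (Fin n → X) → ProbabilityMeasure X // Measurable f})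
    (fun n f ε => ∀ (η : ℝ) (hη : η ∈ Set.Ioo (0 : ℝ) 1) (q : ProbabilityMeasure X), ∀ p ∈ Q,
        ENNReal.ofReal (1 - ε) ≤ iidSample (mixture η hη q p) n
          {S | tvDist (f.1 S) (mixture η hη q p) ≤ 3 * η + ε})
    (fun n f ε ε' hεε' h η hη q p hp => (ENNReal.ofReal_le_ofReal (by linarith)).trans
      ((h η hη q p hp).trans (measure_mono fun S hS => by
        have hS' : tvDist (f.1 S) (mixture η hη q p) ≤ 3 * η + ε := hS
        exact hS'.trans (by linarith)))) hstep
  choose! n₀ hn₀ using hf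
  -- So far one parameter bounds both the error and the failure probability; `min ε δ` serves for
  -- both.
  refine ⟨⟨fun n => (f n).1, fun n => (f n).2⟩, fun ε δ => n₀ (min ε δ), ?_⟩
  intro η hη q p hp ε hε δ hδ n hn
  have hmin : min ε δ ∈ Set.Ioo (0 : ℝ) 1 := ⟨lt_min hε.1 hδ.1, (min_le_left _ _).trans_lt hε.2⟩
  refine (ENNReal.ofReal_le_ofReal (by linarith [min_le_right ε δ])).trans
    ((hn₀ _ hmin n hn η hη q p hp).trans (measure_mono fun S hS => ?_))
  have hS' : tvDist ((f n).1 S) (mixture η hη q p) ≤ 3 * η + min ε δ := hS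
  exact hS'.trans (by linarith [min_le_left ε δ])

end AdditiveRobustness

/-! ### Differential privacy by random subsampling. -/

section Subsampling

variable {X : Type*} [MeasurableSpace X]

lemma measurePreserving_comp_of_injective (p : ProbabilityMeasure X) {m n : ℕ} {e : Fin m → Fin n}
    (he : e.Injective) :
    MeasurePreserving (fun (x : Fin n → X) t => x (e t)) (iidSample p n) (iidSample p m) := by
  have hmeas : Measurable fun (x : Fin n → X) t => x (e t) := by fun_prop
  refine ⟨hmeas, ?_⟩
  have hind : iIndepFun (fun (i : Fin n) (x : Fin n → X) => x i) (iidSample p n) :=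
    iIndepFun_pi (X := fun _ => id) fun _ => aemeasurable_id
  have h := (iIndepFun_iff_map_fun_eq_pi_map fun t => (measurable_pi_apply (e t)).aemeasurable).1
    (hind.precomp he)
  rw [h, iidSample]
  congr 1
  ext1 t
  exact (measurePreserving_eval (fun _ : Fin n => (p : Measure X)) (e t)).map_eq

/-- The `t`-th position of the `b`-th of `m + 1` disjoint blocks of size `m` in `Fin n`. -/
def blockPos {m n : ℕ} (h : (m + 1) * m ≤ n) (b : Fin (m + 1)) (t : Fin m) : Fin n :=
  Fin.castLE h (finProdFinEquiv (b, t))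

lemma blockPos_inj {m n : ℕ} (h : (m + 1) * m ≤ n) {b b' : Fin (m + 1)} {t t' : Fin m}
    (heq : blockPos h b t = blockPos h b' t') : b = b' ∧ t = t' := by
  simpa [blockPos] using heq

/-- Run `f` on one of `m + 1` disjoint blocks of size `m`, chosen uniformly at random. -/
noncomputable def subsampleKernel {Y : Type*} [MeasurableSpace Y] {m n : ℕ} (h : (m + 1) * m ≤ n)
    (f : (Fin m → X) → Y) (hf : Measurable f) : Kernel (Fin n → X) Y where
  toFun x := ∑ b : Fin (m + 1), ((m : ENNReal) + 1)⁻¹ •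
    Measure.dirac (f fun t => x (blockPos h b t))
  measurable' := by
    refine Measure.measurable_of_measurable_coe _ fun B hB => ?_
    simp only [Measure.coe_finsetSum, Finset.sum_apply, Measure.smul_apply, smul_eq_mul]
    refine Finset.measurable_sum _ fun b _ => Measurable.const_mul ?_ _
    exact (Measure.measurable_coe hB).comp (Measure.measurable_dirac.comp (hf.comp (by fun_prop)))

variable {Y : Type*} [MeasurableSpace Y] {m n : ℕ} (h : (m + 1) * m ≤ n)
  {f : (Fin m → X) → Y} (hf : Measurable f)

lemma subsampleKernel_apply (x : Fin n → X) {B : Set Y} (hB : MeasurableSet B) :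
    subsampleKernel h f hf x B =
      ((m : ENNReal) + 1)⁻¹ * ∑ b, B.indicator 1 (f fun t => x (blockPos h b t)) := by
  change (∑ b : Fin (m + 1), ((m : ENNReal) + 1)⁻¹ •
    Measure.dirac (f fun t => x (blockPos h b t))) B = _
  simp [Measure.dirac_apply' _ hB, Finset.mul_sum]

lemma inv_mul_add_one_cancel (m : ℕ) : ((m : ENNReal) + 1)⁻¹ * (m + 1) = 1 :=
  ENNReal.inv_mul_cancel (by simp) (by simp)

instance : IsMarkovKernel (subsampleKernel h f hf) :=
  ⟨fun x => ⟨by simp [subsampleKernel_apply h hf x .univ, inv_mul_add_one_cancel]⟩⟩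

/-- The changed entry lies in at most one of the disjoint blocks, and that block is selected with
probability `1 / (m + 1)`; otherwise the output is the same. -/
lemma isDP_subsampleKernel {ε δ : ℝ} (hε : 0 ≤ ε) (hδ : 1 / ((m : ℝ) + 1) ≤ δ) :
    IsDP ε δ (subsampleKernel h f hf) := by
  classical
  rintro x x' ⟨i, -, hi⟩ B hB
  have hone : ∑ b : Fin (m + 1), (if ∃ t, blockPos h b t = i then (1 : ENNReal) else 0) ≤ 1 := by
    rw [Finset.sum_boole]
    have : (Finset.univ.filter fun b : Fin (m + 1) => ∃ t, blockPos h b t = i).card ≤ 1 := by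
      refine Finset.card_le_one.2 fun b hb b' hb' => ?_
      obtain ⟨t, ht⟩ := (Finset.mem_filter.1 hb).2
      obtain ⟨t', ht'⟩ := (Finset.mem_filter.1 hb').2
      exact (blockPos_inj h (ht.trans ht'.symm)).1
    exact_mod_cast this
  have hterm : ∀ b, B.indicator (1 : Y → ENNReal) (f fun t => x (blockPos h b t)) ≤
      B.indicator 1 (f fun t => x' (blockPos h b t)) +
        if ∃ t, blockPos h b t = i then 1 else 0 := fun b => by
    by_cases hb : ∃ t, blockPos h b t = i
    · rw [if_pos hb]
      exact (Set.indicator_le_self' (by simp) _).trans le_add_self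
    · rw [if_neg hb, add_zero]
      have : (fun t => x (blockPos h b t)) = fun t => x' (blockPos h b t) :=
        funext fun t => hi _ fun ht => hb ⟨t, ht⟩
      rw [this]
  have hδ' : ((m : ENNReal) + 1)⁻¹ ≤ ENNReal.ofReal δ := by
    refine le_trans (le_of_eq ?_) (ENNReal.ofReal_le_ofReal hδ)
    rw [one_div, ENNReal.ofReal_inv_of_pos (by positivity),
      ENNReal.ofReal_add (by positivity) zero_le_one]
    simp
  have hexp : (1 : ENNReal) ≤ ENNReal.ofReal (Real.exp ε) :=
    ENNReal.one_le_ofReal.2 (Real.one_le_exp hε)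
  calc subsampleKernel h f hf x B
      ≤ ((m : ENNReal) + 1)⁻¹ * (∑ b, B.indicator 1 (f fun t => x' (blockPos h b t)) + 1) := by
        rw [subsampleKernel_apply h hf x hB]
        gcongr
        refine (Finset.sum_le_sum fun b _ => hterm b).trans ?_
        rw [Finset.sum_add_distrib]
        gcongr
    _ = 1 * subsampleKernel h f hf x' B + ((m : ENNReal) + 1)⁻¹ := by
        rw [subsampleKernel_apply h hf x' hB, mul_add, mul_one, one_mul]
    _ ≤ _ := by gcongr

/-- Every block is itself an i.i.d. sample of size `m`, so the random choice of a block does not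
affect the output law. -/
lemma subsampleKernel_comp_iidSample (p : ProbabilityMeasure X) {B : Set Y}
    (hB : MeasurableSet B) :
    (subsampleKernel h f hf ∘ₘ iidSample p n) B = iidSample p m (f ⁻¹' B) := by
  rw [Measure.bind_apply hB (Kernel.aemeasurable _)]
  simp_rw [subsampleKernel_apply h hf _ hB]
  have hb : ∀ b : Fin (m + 1), Measurable fun x : Fin n → X =>
      B.indicator (1 : Y → ENNReal) (f fun t => x (blockPos h b t)) := fun b =>
    (measurable_one.indicator hB).comp (hf.comp (by fun_prop))
  rw [lintegral_const_mul _ (Finset.measurable_sum _ fun b _ => hb b),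
    lintegral_finsetSum _ fun b _ => hb b]
  have hint : ∀ b : Fin (m + 1), ∫⁻ x, B.indicator (1 : Y → ENNReal)
      (f fun t => x (blockPos h b t)) ∂(iidSample p n) = iidSample p m (f ⁻¹' B) := fun b => by
    have hpres := measurePreserving_comp_of_injective p (e := blockPos h b)
      fun t t' htt' => (blockPos_inj h htt').2
    rw [hpres.lintegral_comp (f := fun y => B.indicator (1 : Y → ENNReal) (f y))
      ((measurable_one.indicator hB).comp hf)]
    exact lintegral_indicator_one (hf hB)
  simp only [hint, Finset.sum_const, Finset.card_univ, Fintype.card_fin, nsmul_eq_mul]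
  rw [← mul_assoc]
  push_cast
  rw [inv_mul_add_one_cancel, one_mul]

/-- A learner on the class `Q` yields a differentially private one by random subsampling. -/
lemma approxDPLearnable_of_learner [MeasurableSpace.CountablyGenerated X]
    {Q : Set (ProbabilityMeasure X)} (A : Learner X)
    (hA : ∀ α ∈ Set.Ioo (0 : ℝ) 1, ∀ β ∈ Set.Ioo (0 : ℝ) 1, ∃ m₀, ∀ m ≥ m₀, ∀ p ∈ Q,
      ENNReal.ofReal (1 - β) ≤ iidSample p m {S | tvDist p (A.out m S) ≤ α}) :
    ApproxDPLearnable Q := by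
  choose! m₀ hm₀ using hA
  -- The block size is `√n - 1`, so the `√n` blocks fit into `n` entries; truncated subtraction
  -- gives empty blocks for `n = 0`.
  have hle : ∀ n, (n.sqrt - 1 + 1) * (n.sqrt - 1) ≤ n := fun n => by
    rcases Nat.eq_zero_or_pos n.sqrt with h0 | h0
    · simp [h0]
    · rw [Nat.sub_add_cancel h0]
      exact (Nat.mul_le_mul_left _ (Nat.sub_le _ _)).trans (Nat.sqrt_le n)
  refine ⟨⟨fun n => subsampleKernel (hle n) (A.out _) (A.measurable_out _), fun n => inferInstance⟩,
    fun α β _ δ => (max (m₀ α β) ⌈1 / δ⌉₊ + 1) ^ 2, fun p hp α hα β hβ ε hε δ hδ n hn => ?_⟩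
  have hsqrt : max (m₀ α β) ⌈1 / δ⌉₊ ≤ n.sqrt - 1 := by
    have : max (m₀ α β) ⌈1 / δ⌉₊ + 1 ≤ n.sqrt := Nat.le_sqrt'.2 hn
    omega
  constructor
  · refine isDP_subsampleKernel (hle n) (A.measurable_out _) hε.1.le ?_
    have h1 : 1 / δ ≤ ((n.sqrt - 1 : ℕ) : ℝ) :=
      (Nat.le_ceil _).trans (by exact_mod_cast (le_max_right _ _).trans hsqrt)
    rw [div_le_iff₀ (by positivity)]
    rw [div_le_iff₀ hδ.1] at h1
    nlinarith [hδ.1]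
  · have hS := measurableSet_tvDist_le p α
    change _ ≤ (subsampleKernel (hle n) _ (A.measurable_out _) ∘ₘ iidSample p n) _
    rw [subsampleKernel_comp_iidSample (hle n) (A.measurable_out _) p hS]
    exact hm₀ α hα β hβ _ ((le_max_left _ _).trans hsqrt) p hp

end Subsampling

/-! ### The hard class and its private learner. -/

section HardClass

/-- The weight of the part of the distribution that is hard to learn. -/
noncomputable def hardWeight (j : ℕ) : ℝ := 1 / ((j : ℝ) + 2)

lemma hardWeight_mem (j : ℕ) : hardWeight j ∈ Set.Ioo (0 : ℝ) 1 :=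
  ⟨by unfold hardWeight; positivity,
    (div_lt_one (by positivity)).2 (by linarith [j.cast_nonneg (α := ℝ)])⟩

lemma hardWeight_sq_mem (j : ℕ) : hardWeight j ^ 2 ∈ Set.Ioo (0 : ℝ) 1 :=
  ⟨pow_pos (hardWeight_mem j).1 2,
    pow_lt_one₀ (hardWeight_mem j).1.le (hardWeight_mem j).2 two_ne_zero⟩

/-- The point mass at `x`. -/
noncomputable def pointMass {X : Type*} [MeasurableSpace X] (x : X) : ProbabilityMeasure X :=
  ⟨Measure.dirac x, inferInstance⟩

/-- The uniform distribution on `{1, …, N + 1}`. -/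
noncomputable def uniformIcc (N : ℕ) : ProbabilityMeasure ℕ :=
  ⟨(PMF.uniformOfFinset (Finset.Icc 1 (N + 1)) (Finset.nonempty_Icc.2 (by simp))).toMeasure,
    inferInstance⟩

/-- The law of the position of an observation: `0` most of the time, and otherwise uniform on
`{1, …, N + 1}`. -/
noncomputable def positionLaw (j N : ℕ) : ProbabilityMeasure ℕ :=
  mixture (hardWeight j) (hardWeight_mem j) (uniformIcc N) (pointMass 0)

/-- The observation at a position: besides the position, it reveals whether the position belongs
to `b`. -/
def observe (b : Finset ℕ) (i : ℕ) : ℕ × ℕ :=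
  if i = 0 then (0, 0) else (2 * i + if i ∈ b then 1 else 0, 2)

/-- The law of an observation. -/
noncomputable def observationLaw (j N : ℕ) (b : Finset ℕ) : ProbabilityMeasure (ℕ × ℕ) :=
  (positionLaw j N).map (f := observe b) (Measurable.of_discrete).aemeasurable

/-- The point that identifies the parameters. -/
def codePoint (a : ℕ × ℕ × Finset ℕ) : ℕ × ℕ := (Encodable.encode a, 1)

/-- The law of an observation, mixed with a small point mass that identifies the parameters. -/
noncomputable def codedLaw (a : ℕ × ℕ × Finset ℕ) : ProbabilityMeasure (ℕ × ℕ) :=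
  mixture (hardWeight a.1 ^ 2) (hardWeight_sq_mem a.1) (pointMass (codePoint a))
    (observationLaw a.1 a.2.1 a.2.2)

lemma codePoint_injective : Function.Injective codePoint := fun _ _ h =>
  Encodable.encode_injective (congrArg Prod.fst h)

lemma pointMass_real_apply {X : Type*} [MeasurableSpace X] (x : X) {B : Set X}
    (hB : MeasurableSet B) : (pointMass x : Measure X).real B = B.indicator 1 x := by
  change (Measure.dirac x).real B = _
  by_cases hx : x ∈ B <;> simp [measureReal_def, Measure.dirac_apply' _ hB, hx]

lemma observationLaw_eq_map (j N : ℕ) (b : Finset ℕ) :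
    (observationLaw j N b : Measure (ℕ × ℕ)) = (positionLaw j N : Measure ℕ).map (observe b) := rfl

lemma observationLaw_real_apply (j N : ℕ) (b : Finset ℕ) (B : Set (ℕ × ℕ)) :
    (observationLaw j N b : Measure (ℕ × ℕ)).real B =
      (positionLaw j N : Measure ℕ).real (observe b ⁻¹' B) := by
  rw [observationLaw_eq_map, map_measureReal_apply .of_discrete .of_discrete]

lemma tvDist_observationLaw_le (j N : ℕ) (b : Finset ℕ) :
    tvDist (observationLaw j N b) (pointMass (0, 0)) ≤ hardWeight j := by
  refine tvDist_le fun B hB => ?_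
  have h : (pointMass ((0, 0) : ℕ × ℕ) : Measure (ℕ × ℕ)).real B =
      (pointMass 0 : Measure ℕ).real (observe b ⁻¹' B) := by
    rw [pointMass_real_apply _ hB, pointMass_real_apply _ .of_discrete]
    rfl
  rw [observationLaw_real_apply, h]
  refine (abs_measureReal_sub_le_tvDist _ _ .of_discrete).trans ?_
  rw [tvDist_comm]
  exact tvDist_mixture_le _ _ _

lemma tvDist_codedLaw_le (a : ℕ × ℕ × Finset ℕ) :
    tvDist (codedLaw a) (pointMass (0, 0)) ≤ 2 * hardWeight a.1 := by
  have h1 : tvDist (observationLaw a.1 a.2.1 a.2.2) (codedLaw a) ≤ hardWeight a.1 ^ 2 :=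
    tvDist_mixture_le _ _ _
  have h2 := tvDist_triangle (codedLaw a) (observationLaw a.1 a.2.1 a.2.2) (pointMass (0, 0))
  have h3 := tvDist_observationLaw_le a.1 a.2.1 a.2.2
  rw [tvDist_comm (codedLaw a) (observationLaw _ _ _)] at h2
  have h4 := hardWeight_mem a.1
  nlinarith [h4.1, h4.2]

/-- Code points have second coordinate `1` while observations have `0` or `2`, so almost surely no
foreign code appears and decoding is unambiguous. -/
lemma codedLaw_ne_codePoint (a : ℕ × ℕ × Finset ℕ) :
    ∀ᵐ x ∂(codedLaw a : Measure (ℕ × ℕ)), ∀ a', x = codePoint a' → a' = a := by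
  rw [ae_iff, ← measureReal_eq_zero_iff, codedLaw, mixture_real_apply,
    pointMass_real_apply _ .of_discrete, observationLaw_real_apply]
  have h1 : observe a.2.2 ⁻¹' {x | ¬ ∀ a', x = codePoint a' → a' = a} = ∅ := by
    ext i
    by_cases hi : i = 0 <;> simp [observe, codePoint, hi]
  have h2 : codePoint a ∉ {x | ¬ ∀ a', x = codePoint a' → a' = a} := by
    simp only [Set.mem_ofPred_eq, not_not]
    exact fun a' h => (codePoint_injective h).symm
  rw [h1, Set.indicator_of_notMem h2]
  simp

lemma codedLaw_compl_codePoint_le (a : ℕ × ℕ × Finset ℕ) :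
    (codedLaw a : Measure (ℕ × ℕ)).real {codePoint a}ᶜ ≤ 1 - hardWeight a.1 ^ 2 := by
  rw [probReal_compl_eq_one_sub .of_discrete, codedLaw, mixture_real_apply,
    pointMass_real_apply _ .of_discrete]
  have h1 : 0 ≤ (observationLaw a.1 a.2.1 a.2.2 : Measure (ℕ × ℕ)).real {codePoint a} :=
    measureReal_nonneg
  have h2 := hardWeight_sq_mem a.1
  have := mul_nonneg (sub_nonneg.2 h2.2.le) h1
  simp only [Set.mem_singleton_iff, Set.indicator_of_mem, Pi.one_apply]
  linarith

open Classical in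
/-- Output the law identified by a code point in the sample, if there is any. -/
noncomputable def decoder : Learner (ℕ × ℕ) where
  out _ S := if h : ∃ a, ∃ t, S t = codePoint a then codedLaw h.choose else pointMass (0, 0)
  measurable_out _ := Measurable.of_discrete

lemma approxDPLearnable_range_codedLaw : ApproxDPLearnable (Set.range codedLaw) := by
  refine approxDPLearnable_of_learner decoder fun α hα β hβ => ?_
  -- In the only case where the code point must be seen, `2 * hardWeight a.1 > α`, its mass is at
  -- least `(α / 2) ^ 2`. Hence the sample size does not depend on the law.
  obtain ⟨m₀, hm₀⟩ := exists_pow_lt_of_lt_one hβ.1 (show 1 - (α / 2) ^ 2 < 1 by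
    nlinarith [sq_pos_of_pos hα.1])
  refine ⟨m₀, ?_⟩
  rintro m hm _ ⟨a, rfl⟩
  rw [ofReal_one_sub_le_iff_measure_compl_le _ .of_discrete hβ.1.le]
  have hae : ∀ᵐ S ∂(iidSample (codedLaw a) m), ∀ t, ∀ a', S t = codePoint a' → a' = a := by
    refine ae_all_iff.2 fun t => ?_
    exact (measurePreserving_eval (fun _ : Fin m => (codedLaw a : Measure (ℕ × ℕ))) t
      ).quasiMeasurePreserving.ae (codedLaw_ne_codePoint a)
  have hout : ∀ S : Fin m → ℕ × ℕ, (∀ t, ∀ a', S t = codePoint a' → a' = a) →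
      ((∃ t, S t = codePoint a) → decoder.out m S = codedLaw a) ∧
      ((¬ ∃ t, S t = codePoint a) → decoder.out m S = pointMass (0, 0)) := by
    intro S hS
    constructor
    · intro h
      have h' : ∃ a, ∃ t, S t = codePoint a := ⟨a, h⟩
      obtain ⟨t, ht⟩ := h'.choose_spec
      simp only [decoder, h', dite_true, hS t _ ht]
    · intro h
      have h' : ¬ ∃ a, ∃ t, S t = codePoint a := by
        rintro ⟨a', t, ht⟩
        exact h ⟨t, by rw [ht, hS t a' ht]⟩
      simp only [decoder, h', dite_false]
  -- If the hard part is light, the default output is accurate as well; if it is heavy, failure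
  -- forces the sample to miss the code point.
  rcases le_or_gt (2 * hardWeight a.1) α with hsmall | hlarge
  · have hgood : ∀ᵐ S ∂(iidSample (codedLaw a) m), tvDist (codedLaw a) (decoder.out m S) ≤ α := by
      filter_upwards [hae] with S hS
      by_cases h : ∃ t, S t = codePoint a
      · rw [(hout S hS).1 h, tvDist_self]
        exact hα.1.le
      · rw [(hout S hS).2 h]
        exact (tvDist_codedLaw_le a).trans hsmall
    exact (ae_iff.1 hgood).trans_le zero_le
  · have hsub : iidSample (codedLaw a) m {S | tvDist (codedLaw a) (decoder.out m S) ≤ α}ᶜ ≤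
        iidSample (codedLaw a) m (Set.univ.pi fun _ => {codePoint a}ᶜ) := by
      refine measure_mono_ae ?_
      filter_upwards [hae] with S hS hfail t _ ht
      refine hfail ?_
      change tvDist (codedLaw a) (decoder.out m S) ≤ α
      rw [(hout S hS).1 ⟨t, ht⟩, tvDist_self]
      exact hα.1.le
    refine hsub.trans ?_
    rw [iidSample, Measure.pi_pi, Finset.prod_const, Finset.card_univ, Fintype.card_fin,
      ← ofReal_measureReal, ← ENNReal.ofReal_pow measureReal_nonneg]
    refine ENNReal.ofReal_le_ofReal (le_trans ?_ hm₀.le)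
    have h1 : 1 - hardWeight a.1 ^ 2 ≤ 1 - (α / 2) ^ 2 := by nlinarith [hα.1]
    have h0 : 0 ≤ 1 - (α / 2) ^ 2 := by nlinarith [hα.1, hα.2]
    exact (pow_le_pow_left₀ measureReal_nonneg ((codedLaw_compl_codePoint_le a).trans h1) m).trans
      (pow_le_pow_of_le_one h0 (by nlinarith [hα.1]) hm)

end HardClass

/-! ### Lower bound once the code point is removed. -/

section LowerBound

lemma half_le_uniformIcc {n N : ℕ} (hnN : 2 * n ≤ N + 1) (J : Fin n → ℕ) :
    1 / 2 ≤ (uniformIcc N : Measure ℕ).real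
      ↑(Finset.Icc 1 (N + 1) \ Finset.univ.image J) := by
  classical
  change 1 / 2 ≤ (PMF.uniformOfFinset (Finset.Icc 1 (N + 1)) _).toMeasure.real _
  rw [measureReal_def, PMF.toMeasure_uniformOfFinset_apply _ _ .of_discrete]
  have h1 : ∀ _ : DecidablePred (· ∈ (↑(Finset.Icc 1 (N + 1) \ Finset.univ.image J) : Set ℕ)),
      (Finset.Icc 1 (N + 1)).filter
        (· ∈ (↑(Finset.Icc 1 (N + 1) \ Finset.univ.image J) : Set ℕ)) =
      Finset.Icc 1 (N + 1) \ Finset.univ.image J := fun _ => by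
    ext i; simp
  have h2 : N + 1 ≤ (Finset.Icc 1 (N + 1) \ Finset.univ.image J).card + n := by
    have h3 := Finset.le_card_sdiff (Finset.univ.image J) (Finset.Icc 1 (N + 1))
    have h4 : (Finset.univ.image J).card ≤ n := Finset.card_image_le.trans (by simp)
    rw [Nat.card_Icc] at h3
    omega
  rw [h1, Nat.card_Icc, Nat.add_sub_cancel, ENNReal.toReal_div]
  simp only [ENNReal.toReal_natCast]
  rw [div_le_div_iff₀ two_pos (by positivity)]
  have h5 : N + 1 ≤ 2 * (Finset.Icc 1 (N + 1) \ Finset.univ.image J).card := by omega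
  have h6 : ((N + 1 : ℕ) : ℝ) ≤ 2 * (Finset.Icc 1 (N + 1) \ Finset.univ.image J).card := by
    exact_mod_cast h5
  simpa [mul_comm] using h6

/-- Changing the membership of all positions in `F` moves the law of an observation by at least
the weight of `F`. -/
lemma le_tvDist_observationLaw_symmDiff (j N : ℕ) (b F : Finset ℕ) (hF : 0 ∉ F) :
    hardWeight j * (uniformIcc N : Measure ℕ).real F ≤
      tvDist (observationLaw j N b) (observationLaw j N (symmDiff b F)) := by
  have h1 : (F : Set ℕ) ⊆ observe b ⁻¹' (observe b '' F) := Set.subset_preimage_image _ _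
  -- Every position in `F` shows the opposite bit under the flipped set, so the event `observe b ''
  -- F` separates the two laws.
  have h2 : observe (symmDiff b F) ⁻¹' (observe b '' F) = ∅ := by
    refine Set.eq_empty_of_forall_notMem ?_
    rintro i ⟨l, hl, hli⟩
    have hl' : l ∈ F := hl
    have hl0 : l ≠ 0 := fun h => hF (h ▸ hl')
    rcases eq_or_ne i 0 with rfl | hi
    · simp [observe, hl0] at hli
    · simp only [observe, hl0, hi, if_false, Prod.mk.injEq, and_true] at hli
      have : i = l := by split_ifs at hli <;> omega
      subst this
      by_cases hb : i ∈ b <;> simp [Finset.mem_symmDiff, hb, hl'] at hli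
  have h3 := (le_abs_self _).trans (abs_measureReal_sub_le_tvDist (observationLaw j N b)
    (observationLaw j N (symmDiff b F)) (B := observe b '' F) .of_discrete)
  rw [observationLaw_real_apply, observationLaw_real_apply, h2, measureReal_empty, sub_zero] at h3
  refine le_trans ?_ ((measureReal_mono h1).trans h3)
  rw [positionLaw, mixture_real_apply]
  have h4 := mul_nonneg (sub_nonneg.2 (hardWeight_mem j).2.le)
    (measureReal_nonneg (μ := (pointMass 0 : Measure ℕ)) (s := (F : Set ℕ)))
  linarith

lemma iidSample_observationLaw (j N n : ℕ) (b : Finset ℕ) (E : Set (Fin n → ℕ × ℕ)) :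
    iidSample (observationLaw j N b) n E =
      iidSample (positionLaw j N) n {J | (fun t => observe b (J t)) ∈ E} := by
  have h : iidSample (observationLaw j N b) n =
      (iidSample (positionLaw j N) n).map fun J t => observe b (J t) :=
    (Measure.pi_map_pi (μ := fun _ : Fin n => (positionLaw j N : Measure ℕ))
      (f := fun _ => observe b) fun _ => Measurable.of_discrete.aemeasurable).symm
  rw [h, Measure.map_apply .of_discrete .of_discrete]
  rfl

/-- No learner is accurate for all the laws of observations: membership of the positions that are
absent from the sample cannot be guessed. -/
lemma exists_iidSample_observationLaw_lt (j n : ℕ)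
    (f : (Fin n → ℕ × ℕ) → ProbabilityMeasure (ℕ × ℕ)) {r : ℝ} (hr : r < hardWeight j / 4) :
    ∃ b, iidSample (observationLaw j (2 * n) b) n
      {S | tvDist (f S) (observationLaw j (2 * n) b) ≤ r} < ENNReal.ofReal (3 / 4) := by
  classical
  by_contra! hcon
  -- With more than `2 n` positions, any sample of size `n` leaves at least half of them unseen.
  set N := 2 * n
  set P := iidSample (positionLaw j N) n
  let E : Finset ℕ → Set (Fin n → ℕ) := fun b =>
    {J | tvDist (f fun t => observe b (J t)) (observationLaw j N b) ≤ r}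
  have hE : ∀ b, 3 / 4 ≤ P.real (E b) := fun b => by
    have := hcon b
    rw [iidSample_observationLaw] at this
    exact (ENNReal.ofReal_le_iff_le_toReal (measure_ne_top _ _)).1 this
  set Z := (Finset.Icc 1 (N + 1)).powerset
  have hcount : ∀ J : Fin n → ℕ, 2 * (Z.filter fun b => J ∈ E b).card ≤ Z.card := by
    intro J
    set F := Finset.Icc 1 (N + 1) \ Finset.univ.image J with hF
    -- Flipping the unseen positions leaves the sample unchanged but moves the law by at least
    -- `hardWeight j / 2`, which is more than `2 r`, so the common output cannot be accurate for
    -- both.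
    have hflip : ∀ b, J ∈ E b → J ∉ E (symmDiff b F) := by
      intro b hb hb'
      have hobs : (fun t => observe (symmDiff b F) (J t)) = fun t => observe b (J t) := by
        funext t
        have : J t ∉ F := by simp [hF]
        simp [observe, Finset.mem_symmDiff, this]
      have h1 : tvDist (f fun t => observe b (J t)) (observationLaw j N b) ≤ r := hb
      have h2 : tvDist (f fun t => observe (symmDiff b F) (J t))
        (observationLaw j N (symmDiff b F)) ≤ r := hb'
      rw [hobs] at h2
      have h3 := tvDist_triangle (observationLaw j N b) (f fun t => observe b (J t))
        (observationLaw j N (symmDiff b F))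
      rw [tvDist_comm _ (f _)] at h3
      have h4 := le_tvDist_observationLaw_symmDiff j N b F (by simp [hF])
      have h5 := half_le_uniformIcc (show 2 * n ≤ N + 1 by omega) J
      have h6 := mul_le_mul_of_nonneg_left h5 (hardWeight_mem j).1.le
      linarith
    have hinj : Function.Injective fun b : Finset ℕ => symmDiff b F :=
      symmDiff_left_injective F
    have hdisj : Disjoint (Z.filter fun b => J ∈ E b)
        ((Z.filter fun b => J ∈ E b).image fun b => symmDiff b F) := by
      rw [Finset.disjoint_left]
      intro b hb hb'
      obtain ⟨b₀, hb₀, rfl⟩ := Finset.mem_image.1 hb'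
      exact hflip b₀ (Finset.mem_filter.1 hb₀).2 (Finset.mem_filter.1 hb).2
    calc 2 * (Z.filter fun b => J ∈ E b).card
        = ((Z.filter fun b => J ∈ E b) ∪
            (Z.filter fun b => J ∈ E b).image fun b => symmDiff b F).card := by
          rw [Finset.card_union_of_disjoint hdisj, Finset.card_image_of_injective _ hinj, two_mul]
      _ ≤ Z.card := by
          refine Finset.card_le_card (Finset.union_subset (Finset.filter_subset _ _) ?_)
          intro b hb
          obtain ⟨b₀, hb₀, rfl⟩ := Finset.mem_image.1 hb
          have h1 := Finset.mem_powerset.1 (Finset.mem_filter.1 hb₀).1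
          exact Finset.mem_powerset.2 (Finset.symmDiff_subset_union.trans
            (Finset.union_subset h1 Finset.sdiff_subset))
  have hint : ∀ b, Integrable ((E b).indicator (1 : (Fin n → ℕ) → ℝ)) P := fun b =>
    (integrable_const 1).indicator .of_discrete
  -- All laws are coupled through the same position sample `J`. For each `J` at most half of the
  -- sets `b` succeed, so the average success probability is at most `1 / 2`, contradicting `3 / 4`.
  have hsum : ∑ b ∈ Z, P.real (E b) ≤ Z.card / 2 := by
    calc ∑ b ∈ Z, P.real (E b) = ∫ J, ∑ b ∈ Z, (E b).indicator 1 J ∂P := by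
          rw [integral_finsetSum _ fun b _ => hint b]
          exact Finset.sum_congr rfl fun b _ => (integral_indicator_one .of_discrete).symm
      _ ≤ ∫ _, (Z.card : ℝ) / 2 ∂P := by
          refine integral_mono (integrable_finsetSum _ fun b _ => hint b) (integrable_const _)
            fun J => ?_
          have h1 : ((2 * (Z.filter fun b => J ∈ E b).card : ℕ) : ℝ) ≤ Z.card := by
            exact_mod_cast hcount J
          have h2 : ∑ b ∈ Z, (E b).indicator (1 : (Fin n → ℕ) → ℝ) J =
              (Z.filter fun b => J ∈ E b).card := by
            simp [Set.indicator_apply]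
          dsimp only
          rw [h2]
          push_cast at h1
          linarith
      _ = _ := by simp
  have hlow : (Z.card : ℝ) * (3 / 4) ≤ ∑ b ∈ Z, P.real (E b) := by
    rw [← nsmul_eq_mul]
    exact Finset.card_nsmul_le_sum _ _ _ fun b _ => hE b
  have hZ : (0 : ℝ) < Z.card := by
    exact_mod_cast Finset.card_pos.2 (Finset.powerset_nonempty _)
  linarith

theorem not_subtractiveRobustlyLearnable_range_codedLaw {α : ℝ} (hα : 1 ≤ α) :
    ¬ SubtractiveRobustlyLearnable α (Set.range codedLaw) := by
  rintro ⟨A, nC, hA⟩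
  -- This makes `α v ≤ 1 / 16`, so the promised error `α v² + v / 16` is at most `v / 8`, below the
  -- barrier `v / 4`.
  obtain ⟨j, hj⟩ := exists_nat_ge (16 * α)
  set v := hardWeight j with hv
  obtain ⟨hv0, hv1⟩ := hardWeight_mem j
  have hvα : α * v ≤ 1 / 16 := by
    rw [hv, hardWeight, mul_one_div, div_le_iff₀ (by positivity)]
    linarith
  obtain ⟨b, hb⟩ := exists_iidSample_observationLaw_lt j (nC (v / 16) (1 / 4)) (A.out _)
    (r := α * v ^ 2 + v / 16) (by nlinarith)
  refine hb.not_ge ?_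
  have := hA (v ^ 2) (hardWeight_sq_mem j) (observationLaw j (2 * nC (v / 16) (1 / 4)) b)
    ⟨pointMass (codePoint (j, 2 * nC (v / 16) (1 / 4), b)), (j, 2 * nC (v / 16) (1 / 4), b), rfl⟩
    (v / 16) ⟨by linarith, by linarith⟩ (1 / 4) ⟨by norm_num, by norm_num⟩ _ le_rfl
  rwa [show (1 : ℝ) - 1 / 4 = 3 / 4 by norm_num] at this

/-- If a mixture of `p` with weight `η` of contamination lies in the class, then `p` is within `η`
of the class. -/
lemma RobustlyLearnable.subtractiveRobustlyLearnable {X : Type*} [MeasurableSpace X] {α : ℝ}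
    (hα : 0 ≤ α) {C : Set (ProbabilityMeasure X)} (h : RobustlyLearnable α C) :
    SubtractiveRobustlyLearnable α C := by
  obtain ⟨A, nC, hA⟩ := h
  refine ⟨A, nC, fun η hη p hp ε hε δ hδ n hn => (hA p ε hε δ hδ n hn).trans
    (measure_mono fun S hS => ?_)⟩
  obtain ⟨q, hq⟩ := hp
  have h1 : tvDistToClass p C ≤ ENNReal.ofReal η :=
    (iInf₂_le _ hq).trans (ENNReal.ofReal_le_ofReal (tvDist_mixture_le hη q p))
  have h2 : ENNReal.ofReal (tvDist (A.out n S) p) ≤ ENNReal.ofReal (α * η + ε) := by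
    rw [ENNReal.ofReal_add (mul_nonneg hα hη.1.le) hε.1.le, ENNReal.ofReal_mul hα]
    exact le_trans hS (by gcongr)
  exact (ENNReal.ofReal_le_ofReal_iff (add_nonneg (mul_nonneg hα hη.1.le) hε.1.le)).1 h2

end LowerBound

end DistLearn

theorem mainTheorem7 :
    (∀ (X : Type*) [MeasurableSpace X] [MeasurableSpace.CountablyGenerated X]
      (Q : Set (ProbabilityMeasure X)),
      DistLearn.ApproxDPLearnable Q → DistLearn.AdditiveRobustlyLearnable 3 Q) ∧
    (∃ Q : Set (ProbabilityMeasure (ℕ × ℕ)), DistLearn.ApproxDPLearnable Q ∧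
      ∀ α : ℝ, 1 ≤ α → ¬ DistLearn.RobustlyLearnable α Q) ∧
    (∃ Q : Set (ProbabilityMeasure (ℕ × ℕ)), DistLearn.ApproxDPLearnable Q ∧
      ∀ α : ℝ, 1 ≤ α → ¬ DistLearn.SubtractiveRobustlyLearnable α Q) :=
  ⟨fun _ _ _ _ hQ => DistLearn.additiveRobustlyLearnable_three_of_approxDPLearnable hQ,
    ⟨Set.range DistLearn.codedLaw, DistLearn.approxDPLearnable_range_codedLaw, fun _ hα h =>
      DistLearn.not_subtractiveRobustlyLearnable_range_codedLaw hα
        (h.subtractiveRobustlyLearnable (zero_le_one.trans hα))⟩,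
    ⟨Set.range DistLearn.codedLaw, DistLearn.approxDPLearnable_range_codedLaw, fun _ hα =>
      DistLearn.not_subtractiveRobustlyLearnable_range_codedLaw hα⟩⟩
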